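/- Let $d\ge 1$ and let $\Omega\subset\mathbb R^d$ be a nonempty bounded open set with smooth boundary, outer unit normal $\nu$ and surface measure $\sigma$ on $\partial\Omega$. Let $c\in C^1(\mathbb R^d)$ with $c\ge c_0>0$, let $T>0$, $N\in\mathbb N$, and let $\{\Psi_n\}_{n\ge1}$ be an orthonormal basis of $L^2(0,T)$ whose members $\Psi_1,\dots,\Psi_N$ are absolutely continuous on $[0,T]$; put $s_{mn}=\int_0^T\Psi_n'(t)\Psi_m(t)\,dt$. Let ${\bf x}_0\in\mathbb R^d$, $r({\bf x})=|{\bf x}-{\bf x}_0|$, with $\min_{\overline\Omega} r>1$, and let $b>\max_{\overline\Omega} r$. Then there exist $\lambda_0,\beta_0\in\mathbb R$, depending only on the objects above, such that for all $\lambda\ge\lambda_0$ and $\beta\ge\beta_0$ the following holds. Let $q\in C^1(\mathbb R)$ and $M>0$, put $$q_m(v_1,\dots,v_N)=\int_0^T q\Big(\sum_{n=1}^N v_n\Psi_n(t)\Big)\Psi_m(t)\,dt,\qquad P(s)=\max\{-M\sqrt T,\min\{s,M\sqrt T\}\},$$ let $f_m,g_m\in L^2(\partial\Omega,\sigma)$,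 $1\le m\le N$, and suppose that the set $$H=\{(u_m)_{m=1}^N\in H^2(\Omega)^N:\ u_m|_{\partial\Omega}=f_m,\ \partial_\nu u_m|_{\partial\Omega}=g_m,\ 1\le m\le N\}$$ is nonempty. Define on $H$ $$J^{(0)}(u)=\sum_{m=1}^N\int_\Omega e^{2\lambda b^{-\beta}r^\beta}\Big|\Delta u_m-c\sum_{n=1}^N s_{mn}u_n\Big|^2d{\bf x}$$ and, inductively for $k\ge1$, with $u^{(k-1)}=(u^{(k-1)}_1,\dots,u^{(k-1)}_N)$ the minimizer of $J^{(k-1)}$ on $H$, $$J^{(k)}(u)=\sum_{m=1}^N\int_\Omega e^{2\lambda b^{-\beta}r^\beta}\Big|\Delta u_m-c\sum_{n=1}^N s_{mn}u_n+q_m\big(P(u_1^{(k-1)}),\dots,P(u_N^{(k-1)})\big)\Big|^2d{\bf x}.$$ Then for every $k\ge0$ the functional $J^{(k)}$ has exactly one minimizer in $H$. -/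

import Mathlib

open MeasureTheory Set Filter Topology
open scoped ContDiff

noncomputable section

namespace CarlemanLS

/-- Euclidean space of dimension `d`. -/
abbrev E (d : ℕ) : Type := EuclideanSpace ℝ (Fin d)

/-- The Hilbert space `L²(Ω)` of real functions on `Ω`, modulo equality almost everywhere. -/
abbrev L2 {d : ℕ} (Ω : Set (E d)) : Type := Lp ℝ 2 (volume.restrict Ω)

/-! ### Smooth boundaries, outer normal, surface measure -/

/-- `Ω` has a boundary of class `C^∞`: near each boundary point, `Ω` is the sublevel set `ρ < 0` of
a smooth function with non-vanishing gradient. -/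
def HasSmoothBoundary {d : ℕ} (Ω : Set (E d)) : Prop :=
  ∀ p ∈ frontier Ω, ∃ V : Set (E d), IsOpen V ∧ p ∈ V ∧ ∃ ρ : E d → ℝ,
    ContDiff ℝ ∞ ρ ∧ fderiv ℝ ρ p ≠ 0 ∧ Ω ∩ V = {x ∈ V | ρ x < 0}

/-- `n` is the outer unit normal of `Ω` at `p`: directions making an obtuse angle with `n` enter
`Ω` immediately, directions making an acute angle leave it immediately.  At most one unit vector
has this property; where `Ω` is locally `ρ < 0` with `∇ρ ≠ 0`, it is `∇ρ / |∇ρ|`. -/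
def IsOuterUnitNormal {d : ℕ} (Ω : Set (E d)) (p n : E d) : Prop :=
  ‖n‖ = 1 ∧ ∀ v : E d,
    (inner ℝ v n < 0 → ∀ᶠ t : ℝ in 𝓝[>] 0, p + t • v ∈ Ω) ∧
    (0 < inner ℝ v n → ∀ᶠ t : ℝ in 𝓝[>] 0, p + t • v ∉ Ω)

open Classical in
/-- The outer unit normal field `ν` of `Ω` (set to `0` where there is no outer normal). -/
def outerNormal {d : ℕ} (Ω : Set (E d)) (p : E d) : E d :=
  if h : ∃ n, IsOuterUnitNormal Ω p n then h.choose else 0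

/-- The surface measure `σ` on `∂Ω`: the `(d-1)`-dimensional Hausdorff measure, normalized so that
it agrees with Lebesgue measure on hyperplanes (used for `d ≥ 1`). -/
def surfaceMeasure {d : ℕ} (Ω : Set (E d)) : Measure (E d) :=
  (Measure.euclideanHausdorffMeasure (d - 1) : Measure (E d)).restrict (frontier Ω)

/-! ### Weak derivatives and `H²(Ω)` -/

/-- The classical partial derivative `∂φ/∂xᵢ` of a smooth function. -/
def partialDeriv {d : ℕ} (i : Fin d) (φ : E d → ℝ) (x : E d) : ℝ :=
  fderiv ℝ φ x (EuclideanSpace.single i 1)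

/-- `v ∈ L²(Ω)` is the weak derivative `∂u/∂xᵢ` of `u ∈ L²(Ω)` on the open set `Ω`. -/
def HasWeakPartial {d : ℕ} (Ω : Set (E d)) (i : Fin d) (u v : L2 Ω) : Prop :=
  ∀ φ : E d → ℝ, ContDiff ℝ ∞ φ → HasCompactSupport φ → tsupport φ ⊆ Ω →
    ∫ x in Ω, u x * partialDeriv i φ x = - ∫ x in Ω, v x * φ x

open Classical in
/-- The weak derivative `∂u/∂xᵢ` in `L²(Ω)` (set to `0` if there is none). -/
def weakPartial {d : ℕ} (Ω : Set (E d)) (i : Fin d) (u : L2 Ω) : L2 Ω :=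
  if h : ∃ v, HasWeakPartial Ω i u v then h.choose else 0

/-- `u ∈ H²(Ω)`: all weak derivatives of `u` of first and second order exist in `L²(Ω)`. -/
def MemH2 {d : ℕ} (Ω : Set (E d)) (u : L2 Ω) : Prop :=
  ∃ g : Fin d → L2 Ω, (∀ i, HasWeakPartial Ω i u (g i)) ∧
    ∀ i j, ∃ h : L2 Ω, HasWeakPartial Ω j (g i) h

/-- The weak Laplacian `Δu = ∑ᵢ ∂²u/∂xᵢ²` of `u ∈ H²(Ω)`. -/
def weakLaplacian {d : ℕ} (Ω : Set (E d)) (u : L2 Ω) : L2 Ω :=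
  ∑ i, weakPartial Ω i (weakPartial Ω i u)

/-! ### Boundary values in the sense of the Gauss–Green formulas -/

/-- The trace of `u` on `∂Ω` is `f`:
`∫_Ω (u ∂ᵢφ + ∂ᵢu φ) dx = ∫_∂Ω f φ νᵢ dσ` for every `i` and every test function `φ ∈ C_c^∞(ℝᵈ)`. -/
def HasDirichletTrace {d : ℕ} (Ω : Set (E d)) (u : L2 Ω) (f : E d → ℝ) : Prop :=
  ∀ φ : E d → ℝ, ContDiff ℝ ∞ φ → HasCompactSupport φ → ∀ i : Fin d,
    ∫ x in Ω, (u x * partialDeriv i φ x + weakPartial Ω i u x * φ x) =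
      ∫ x, f x * φ x * (outerNormal Ω x) i ∂(surfaceMeasure Ω)

/-- The normal derivative `∂_ν u` on `∂Ω` is `g`:
`∫_Ω (∇u · ∇φ + Δu φ) dx = ∫_∂Ω g φ dσ` for every test function `φ ∈ C_c^∞(ℝᵈ)`. -/
def HasNeumannTrace {d : ℕ} (Ω : Set (E d)) (u : L2 Ω) (g : E d → ℝ) : Prop :=
  ∀ φ : E d → ℝ, ContDiff ℝ ∞ φ → HasCompactSupport φ →
    ∫ x in Ω, ((∑ i, weakPartial Ω i u x * partialDeriv i φ x) + weakLaplacian Ω u x * φ x) =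
      ∫ x, g x * φ x ∂(surfaceMeasure Ω)

/-- The admissible set `H`: vector functions in `H²(Ω)^N` with `u_m = f_m` and `∂_ν u_m = g_m`
on `∂Ω`. -/
def admissibleSet {d N : ℕ} (Ω : Set (E d)) (f g : Fin N → E d → ℝ) : Set (Fin N → L2 Ω) :=
  {u | ∀ m, MemH2 Ω (u m) ∧ HasDirichletTrace Ω (u m) (f m) ∧ HasNeumannTrace Ω (u m) (g m)}

/-! ### The time basis and the coefficients of the system -/

/-- `(Ψ_n)` is (a choice of representatives of) an orthonormal basis of `L²(0, T)`. -/
def IsOrthonormalBasisL2 (T : ℝ) (Ψ : ℕ → ℝ → ℝ) : Prop :=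
  ∃ e : HilbertBasis ℕ ℝ (Lp ℝ 2 (volume.restrict (Ioo (0 : ℝ) T))),
    ∀ n, Ψ n =ᵐ[volume.restrict (Ioo (0 : ℝ) T)] e n

/-- `s_{mn} = ∫₀ᵀ Ψ_n'(t) Ψ_m(t) dt`. -/
def sCoeff (T : ℝ) (Ψ : ℕ → ℝ → ℝ) (m n : ℕ) : ℝ :=
  ∫ t in (0 : ℝ)..T, deriv (Ψ n) t * Ψ m t

/-- `q_m(v₁, …, v_N) = ∫₀ᵀ q(∑ₙ vₙ Ψₙ(t)) Ψ_m(t) dt`. -/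
def qCoeff {N : ℕ} (T : ℝ) (Ψ : ℕ → ℝ → ℝ) (q : ℝ → ℝ) (m : Fin N) (v : Fin N → ℝ) : ℝ :=
  ∫ t in (0 : ℝ)..T, q (∑ n : Fin N, v n * Ψ n t) * Ψ m t

/-- The cut-off function `P`: truncation at the levels `± M √T`. -/
def cutoff (M T s : ℝ) : ℝ := max (-(M * √T)) (min s (M * √T))

/-! ### The functionals -/

/-- The Carleman weight `exp(2 λ b^{-β} r(x)^β)`, where `r(x) = |x - x₀|`. -/
def carlemanWeight {d : ℕ} (x₀ : E d) (b lam β : ℝ) (x : E d) : ℝ :=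
  Real.exp (2 * lam * b ^ (-β) * dist x x₀ ^ β)

/-- `∑_m ∫_Ω e^{2 λ b^{-β} r^β} |Δu_m - c ∑ₙ s_{mn} uₙ + F_m|² dx`. -/
def weightedResidual {d N : ℕ} (Ω : Set (E d)) (x₀ : E d) (b lam β : ℝ) (c : E d → ℝ)
    (T : ℝ) (Ψ : ℕ → ℝ → ℝ) (F : Fin N → E d → ℝ) (u : Fin N → L2 Ω) : ℝ :=
  ∑ m : Fin N, ∫ x in Ω, carlemanWeight x₀ b lam β x *
    (weakLaplacian Ω (u m) x - c x * (∑ n : Fin N, sCoeff T Ψ m n * u n x) + F m x) ^ 2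

/-- The functionals `J^{(k)}`, where `U k = (u_1^{(k)}, …, u_N^{(k)})` are the iterates: `J^{(0)}`
does not involve `U`, and `J^{(k+1)}` involves `U k` only. -/
def J {d N : ℕ} (Ω : Set (E d)) (x₀ : E d) (b lam β : ℝ) (c : E d → ℝ)
    (T : ℝ) (Ψ : ℕ → ℝ → ℝ) (q : ℝ → ℝ) (M : ℝ) (U : ℕ → Fin N → L2 Ω) :
    ℕ → (Fin N → L2 Ω) → ℝ
  | 0 => weightedResidual Ω x₀ b lam β c T Ψ (fun _ _ => 0)
  | k + 1 => weightedResidual Ω x₀ b lam β c T Ψ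
      (fun m x => qCoeff T Ψ q m (fun n => cutoff M T (U k n x)))

/-- `u` is a minimizer of `Φ` over `H`, and the only one. -/
def IsUniqueMinimizer {X : Type*} (Φ : X → ℝ) (H : Set X) (u : X) : Prop :=
  u ∈ H ∧ IsMinOn Φ H u ∧ ∀ v ∈ H, IsMinOn Φ H v → v = u

end CarlemanLS

end

noncomputable section

namespace CarlemanLS

/-! ### Fourier series on a box, with half-integer frequencies -/

section FourierSeries

-- Each functional is a squared Hilbert norm `‖B z + y‖ ^ 2`: fix one element of `H` and let `z` run
-- over the differences, functions with vanishing Cauchy data. Together with their gradients and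
-- Laplacians these form a closed space, so existence and uniqueness of the minimizer follow by
-- orthogonal projection (`exists_unique_norm_minimizer`) once `B`, the weighted operator of the
-- system, is bounded below there (`exists_norm_le_systemOp`).
--
-- On the bounded set `Ω` the Carleman weight lies between positive constants and can be divided
-- out, so no largeness of its parameters is needed. The coupling terms are absorbed by a different
-- weight, `exp (τ * x j)` with `τ` large. A function with vanishing Cauchy data, extended by zero,
-- satisfies its equation on the whole space. Its Laplace integral at `ζ = η - i ξ` is therefore
-- multiplied by `∑ i, ζ i ^ 2` when the Laplacian is applied. For `η = τ e_j` this factor has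
-- imaginary part `-2 τ ξ_j`. Expanding in Fourier series on a box with half-integer frequencies
-- keeps `|ξ_j| ≥ π / L`, and Parseval gives `IsZeroTraceTriple.carleman` with a constant growing
-- linearly in `τ`. The same multipliers with `τ = 0` bound the gradient and produce all second
-- derivatives, so adding such a function does not leave `H`.
--
-- The cut-off makes the nonlinear term bounded whatever the previous iterate is, so the minimizers
-- can be built recursively.

local instance unitCircleHaarMeasureSpace : MeasureSpace UnitAddCircle :=
  ⟨AddCircle.haarAddCircle⟩

local instance unitCircleHaarIsProbability :
    IsProbabilityMeasure (volume : Measure UnitAddCircle) :=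
  inferInstanceAs (IsProbabilityMeasure AddCircle.haarAddCircle)

/-- The box `(-L/2, L/2]ᵈ`. -/
def box (d : ℕ) (L : ℝ) : Set (E d) := {x | ∀ i, x i ∈ Ioc (-(L / 2)) (L / 2)}

/-- The section of `x ↦ x / L mod 1` with values in the box `(-L/2, L/2]ᵈ`. -/
def boxSection (d : ℕ) (L : ℝ) (t : UnitAddTorus (Fin d)) : E d :=
  L • WithLp.toLp 2 (UnitAddTorus.measurableEquivPiIoc (fun _ => -(1 / 2 : ℝ)) t).1

lemma measurable_boxSection (d : ℕ) (L : ℝ) : Measurable (boxSection d L) := by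
  unfold boxSection
  exact ((PiLp.volume_preserving_toLp (Fin d)).measurable.comp (measurable_subtype_coe.comp
    (UnitAddTorus.measurableEquivPiIoc _).measurable)).const_smul L

lemma measurableSet_box (d : ℕ) (L : ℝ) : MeasurableSet (box d L) := by
  have : box d L = ⋂ i, (fun x : E d => x i) ⁻¹' Ioc (-(L / 2)) (L / 2) := by
    ext x; simp [box]
  rw [this]
  refine MeasurableSet.iInter fun i => ?_
  have : Measurable fun x : E d => x i := by fun_prop
  exact this measurableSet_Ioc

/-- Cutting the torus open carries Haar measure to Lebesgue measure on a unit cube; the dilation by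
`L` contributes the factor `L ^ (-d)`. -/
lemma map_boxSection (d : ℕ) {L : ℝ} (hL : 0 < L) :
    Measure.map (boxSection d L) volume =
      ENNReal.ofReal ((L ^ d)⁻¹) • (volume : Measure (E d)).restrict (box d L) := by
  set a : Fin d → ℝ := fun _ => -(1 / 2 : ℝ)
  set Q : Set (Fin d → ℝ) := {x | ∀ i, x i ∈ Ioc (a i) (a i + 1)} with hQ
  have hQm : MeasurableSet Q := MeasurableSet.univ_pi' fun i => measurableSet_Ioc
  have h1 : Measure.map (fun t => (UnitAddTorus.measurableEquivPiIoc a t).1) volume =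
      (volume : Measure (Fin d → ℝ)).restrict Q := by
    have := (UnitAddTorus.measurePreserving_equivPiIoc a).map_eq
    refine (Measure.map_map (g := Subtype.val) measurable_subtype_coe
      (UnitAddTorus.measurableEquivPiIoc a).measurable).symm.trans ?_
    rw [this]
    exact map_comap_subtype_coe hQm _
  have hm : Measurable fun x : Fin d → ℝ => L • WithLp.toLp 2 x :=
    (PiLp.volume_preserving_toLp (Fin d)).measurable.const_smul L
  have hpre : (fun x : Fin d → ℝ => L • (WithLp.toLp 2 x : E d)) ⁻¹' box d L = Q := by
    ext x
    simp only [box, mem_preimage, mem_ofPred_eq, mem_Ioc, PiLp.smul_apply, smul_eq_mul, hQ, a]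
    refine forall_congr' fun i => and_congr ⟨fun h => ?_, fun h => ?_⟩ ⟨fun h => ?_, fun h => ?_⟩
    all_goals nlinarith
  have h2 : Measure.map (fun x : Fin d → ℝ => L • (WithLp.toLp 2 x : E d)) volume =
      ENNReal.ofReal ((L ^ d)⁻¹) • (volume : Measure (E d)) := by
    have := Measure.map_addHaar_smul (volume : Measure (E d)) hL.ne'
    rw [← (PiLp.volume_preserving_toLp (Fin d)).map_eq, Measure.map_map (by fun_prop)
      (PiLp.volume_preserving_toLp (Fin d)).measurable] at this
    rw [show (fun x : Fin d → ℝ => L • (WithLp.toLp 2 x : E d)) =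
      (fun y : E d => L • y) ∘ WithLp.toLp 2 from rfl, this,
      (PiLp.volume_preserving_toLp (Fin d)).map_eq]
    simp [abs_of_pos hL]
  have h3 : boxSection d L = (fun x : Fin d → ℝ => L • (WithLp.toLp 2 x : E d)) ∘
      fun t => (UnitAddTorus.measurableEquivPiIoc a t).1 := rfl
  have hv : Measurable fun t => (UnitAddTorus.measurableEquivPiIoc a t).1 :=
    measurable_subtype_coe.comp (UnitAddTorus.measurableEquivPiIoc a).measurable
  rw [h3, ← Measure.map_map hm hv, h1, ← hpre,
    ← Measure.restrict_map hm (measurableSet_box d L), h2, Measure.restrict_smul]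

lemma mFourier_eq_exp_boxSection (d : ℕ) {L : ℝ} (hL : 0 < L) (k : Fin d → ℤ)
    (t : UnitAddTorus (Fin d)) :
    UnitAddTorus.mFourier k t =
      Complex.exp (Complex.I * ∑ i, ((2 * Real.pi * k i / L : ℝ) : ℂ) * (boxSection d L t i : ℝ)) := by
  have ht : ∀ i, t i = (((UnitAddTorus.measurableEquivPiIoc (fun _ : Fin d => -(1 / 2 : ℝ)) t).1 i :
      ℝ) : UnitAddCircle) := fun i =>
    (congrFun ((UnitAddTorus.measurableEquivPiIoc (fun _ => -(1 / 2 : ℝ))).symm_apply_apply t) i).symm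
  have hL' : (L : ℂ) ≠ 0 := by exact_mod_cast hL.ne'
  rw [Finset.mul_sum, Complex.exp_sum]
  simp only [UnitAddTorus.mFourier, ContinuousMap.coe_mk]
  refine Finset.prod_congr rfl fun i _ => ?_
  rw [ht i, fourier_coe_apply]
  congr 1
  simp only [boxSection, PiLp.smul_apply, smul_eq_mul]
  push_cast
  field_simp

/-- The frequencies `(2π/L)(k + (1/2, …, 1/2))`, `k ∈ ℤᵈ`. -/
def freq {d : ℕ} (L : ℝ) (k : Fin d → ℤ) (i : Fin d) : ℝ := 2 * Real.pi * (k i + 1 / 2) / L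

/-- The normalized Fourier coefficients of `f` over `Ω`, at half-integer frequencies. -/
def fourierCoef {d : ℕ} (Ω : Set (E d)) (L : ℝ) (f : E d → ℂ) (k : Fin d → ℤ) : ℂ :=
  ((√(L ^ d))⁻¹ : ℝ) * ∫ x in Ω, Complex.exp (-(Complex.I * ∑ i, (freq L k i : ℂ) * (x i : ℂ))) * f x

lemma fourierCoef_congr {d : ℕ} {Ω : Set (E d)} {L : ℝ} {f g : E d → ℂ}
    (h : f =ᵐ[volume.restrict Ω] g) (k : Fin d → ℤ) : fourierCoef Ω L f k = fourierCoef Ω L g k := by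
  unfold fourierCoef
  congr 1
  apply integral_congr_ae
  filter_upwards [h] with x hx
  rw [hx]

/-- Parseval's identity. -/
theorem hasSum_sq_fourierCoef {d : ℕ} {Ω : Set (E d)} (hΩ : MeasurableSet Ω) {L : ℝ} (hL : 0 < L)
    (hbox : Ω ⊆ box d L) {f : E d → ℂ} (hf : MemLp f 2 (volume.restrict Ω)) :
    HasSum (fun k => ‖fourierCoef Ω L f k‖ ^ 2) (∫ x in Ω, ‖f x‖ ^ 2) := by
  wlog hfm : StronglyMeasurable f generalizing f
  · have hae := hf.1.ae_eq_mk
    have := this ((memLp_congr_ae hae).1 hf) hf.1.stronglyMeasurable_mk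
    simp_rw [fourierCoef_congr hae]
    convert this using 1
    apply integral_congr_ae
    filter_upwards [hae] with x hx
    rw [hx]
  set c : ℝ := (L ^ d)⁻¹ with hc
  have hc0 : 0 < c := by positivity
  -- Modulation by this unimodular factor turns integer frequencies into half-integer ones without
  -- changing the norm.
  set m : E d → ℂ := fun x => Complex.exp (-(Complex.I * ∑ i, ((Real.pi / L : ℝ) : ℂ) * (x i : ℂ)))
    with hm
  have hmc : Continuous m := by fun_prop
  have hm1 : ∀ x, ‖m x‖ = 1 := fun x => by
    simp only [hm]
    rw [show -(Complex.I * ∑ i, ((Real.pi / L : ℝ) : ℂ) * (x i : ℂ)) =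
      ((-∑ i, (Real.pi / L) * x i : ℝ) : ℂ) * Complex.I by push_cast; ring]
    exact Complex.norm_exp_ofReal_mul_I _
  set g : E d → ℂ := Ω.indicator fun x => m x * f x with hg
  have hgm : StronglyMeasurable g := (hmc.stronglyMeasurable.mul hfm).indicator hΩ
  set s := boxSection d L
  have hs : Measurable s := measurable_boxSection d L
  have hmap := map_boxSection d hL
  have key : ∀ G : E d → ℂ, Continuous G → ∫ t, G (s t) * g (s t) =
      c * ∫ x in Ω, G x * (m x * f x) := fun G hG => by
    rw [← integral_map (φ := s) (f := fun x => G x * g x) hs.aemeasurable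
      (hG.stronglyMeasurable.mul hgm).aestronglyMeasurable, hmap, integral_smul_measure]
    rw [ENNReal.toReal_ofReal hc0.le, Complex.real_smul]
    congr 1
    have : (fun x => G x * g x) = Ω.indicator fun x => G x * (m x * f x) := by
      ext x; by_cases hx : x ∈ Ω <;> simp [hg, hx]
    rw [this, setIntegral_indicator hΩ, inter_eq_self_of_subset_right hbox]
  have hgL : MemLp g 2 volume := by
    rw [hg, memLp_indicator_iff_restrict hΩ]
    refine (memLp_congr_norm (hmc.aestronglyMeasurable.mul hf.1) hf.1 (ae_of_all _ fun x => ?_)).2 hf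
    simp [hm1]
  have hF : MemLp (g ∘ s) 2 volume := by
    refine MemLp.comp_of_map ?_ hs.aemeasurable
    rw [hmap]
    exact (hgL.restrict _).smul_measure ENNReal.ofReal_ne_top
  have hP := UnitAddTorus.hasSum_sq_mFourierCoeff (hF.toLp)
  have hcoef : ∀ k, UnitAddTorus.mFourierCoeff (hF.toLp) k =
      (√c : ℝ) * fourierCoef Ω L f k := fun k => by
    have h1 : UnitAddTorus.mFourierCoeff (hF.toLp) k = ∫ t,
      Complex.exp (Complex.I * ∑ i, ((2 * Real.pi * (-k) i / L : ℝ) : ℂ) * (s t i : ℝ)) * g (s t) := by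
      unfold UnitAddTorus.mFourierCoeff
      apply integral_congr_ae
      filter_upwards [hF.coeFn_toLp] with t ht
      rw [ht, mFourier_eq_exp_boxSection d hL, smul_eq_mul]
      push_cast
      rfl
    rw [h1, key (fun x => Complex.exp (Complex.I * ∑ i, ((2 * Real.pi * (-k) i / L : ℝ) : ℂ) *
      (x i : ℝ))) (by fun_prop), fourierCoef, ← mul_assoc]
    congr 1
    · rw [← Real.sqrt_inv, ← Complex.ofReal_mul, Real.mul_self_sqrt hc0.le]
    · refine integral_congr_ae (ae_of_all _ fun x => ?_)
      simp only [hm]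
      rw [← mul_assoc, ← Complex.exp_add]
      congr 2
      simp only [Finset.mul_sum, ← Finset.sum_neg_distrib, ← Finset.sum_add_distrib, freq]
      refine Finset.sum_congr rfl fun i _ => ?_
      simp only [Pi.neg_apply]
      push_cast
      ring
  have hnorm : ∫ t, ‖hF.toLp (g ∘ s) t‖ ^ 2 = c * ∫ x in Ω, ‖f x‖ ^ 2 := by
    have h1 : ∫ t, ‖hF.toLp (g ∘ s) t‖ ^ 2 = ∫ t, ‖g (s t)‖ ^ 2 := by
      apply integral_congr_ae
      filter_upwards [hF.coeFn_toLp] with t ht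
      rw [ht]; rfl
    rw [h1, ← integral_map (φ := s) (f := fun x => ‖g x‖ ^ 2) hs.aemeasurable
      ((hgm.norm.pow 2).aestronglyMeasurable), hmap, integral_smul_measure,
      ENNReal.toReal_ofReal hc0.le, smul_eq_mul]
    congr 1
    have : (fun x => ‖g x‖ ^ 2) = Ω.indicator fun x => ‖f x‖ ^ 2 := by
      ext x; by_cases hx : x ∈ Ω <;> simp [hg, hx, hm1]
    rw [this, setIntegral_indicator hΩ, inter_eq_self_of_subset_right hbox]
  rw [hnorm] at hP
  simp_rw [hcoef, norm_mul, mul_pow, Complex.norm_real, Real.norm_eq_abs, sq_abs,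
    Real.sq_sqrt hc0.le] at hP
  have := hP.mul_left c⁻¹
  simpa [← mul_assoc, inv_mul_cancel₀ hc0.ne'] using this

end FourierSeries

/-! ### Square-integrable functions on bounded sets, and Laplace integrals. -/

lemma integrable_of_memLp_two {d : ℕ} {Ω : Set (E d)} (hΩ : Bornology.IsBounded Ω) {F : Type*}
    [NormedAddCommGroup F] {f : E d → F} (hf : MemLp f 2 (volume.restrict Ω)) :
    IntegrableOn f Ω := by
  have : IsFiniteMeasure (volume.restrict Ω) := ⟨by simpa using hΩ.measure_lt_top⟩
  exact hf.integrable (by norm_num)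

lemma integrable_continuous_mul {d : ℕ} {Ω : Set (E d)} (hΩ : Bornology.IsBounded Ω)
    (hΩm : MeasurableSet Ω) {𝕜 : Type*} [RCLike 𝕜] {f w : E d → 𝕜} (hf : IntegrableOn f Ω)
    (hw : Continuous w) : IntegrableOn (fun x => w x * f x) Ω := by
  obtain ⟨C, hC⟩ := (hΩ.isCompact_closure.image hw.norm).isBounded.bddAbove
  refine Integrable.bdd_mul (c := C) hf hw.aestronglyMeasurable ?_
  filter_upwards [ae_restrict_mem hΩm] with x hx
  exact hC ⟨x, subset_closure hx, rfl⟩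

lemma memLp_continuous_mul {d : ℕ} {Ω : Set (E d)} (hΩ : Bornology.IsBounded Ω)
    (hΩm : MeasurableSet Ω) {𝕜 : Type*} [RCLike 𝕜] {f w : E d → 𝕜}
    (hf : MemLp f 2 (volume.restrict Ω)) (hw : Continuous w) :
    MemLp (fun x => w x * f x) 2 (volume.restrict Ω) := by
  obtain ⟨C, hC⟩ := (hΩ.isCompact_closure.image hw.norm).isBounded.bddAbove
  refine MemLp.of_le_mul (c := C) hf (hw.aestronglyMeasurable.mul hf.1) ?_
  filter_upwards [ae_restrict_mem hΩm] with x hx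
  rw [norm_mul]
  exact mul_le_mul_of_nonneg_right (hC ⟨x, subset_closure hx, rfl⟩) (norm_nonneg _)

lemma norm_sq_Lp_two {α 𝕜 : Type*} [RCLike 𝕜] [MeasurableSpace α] {μ : Measure α} (f : Lp 𝕜 2 μ) :
    ‖f‖ ^ 2 = ∫ x, ‖f x‖ ^ 2 ∂μ := by
  have h := congrArg RCLike.re (L2.inner_def (𝕜 := 𝕜) f f)
  rw [← norm_sq_eq_re_inner (𝕜 := 𝕜), ← integral_re (L2.integrable_inner f f)] at h
  simpa only [← norm_sq_eq_re_inner] using h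

lemma continuous_exp_freq {d : ℕ} (L : ℝ) (k : Fin d → ℤ) : Continuous fun x : E d =>
    Complex.exp (-(Complex.I * ∑ i, (freq L k i : ℂ) * (x i : ℂ))) := by fun_prop

/-- The Fourier coefficients as a linear isometry `L²(Ω; ℂ) → ℓ²(ℤᵈ; ℂ)`. -/
theorem exists_fourierIsometry {d : ℕ} {Ω : Set (E d)} (hΩ : MeasurableSet Ω)
    (hΩb : Bornology.IsBounded Ω) {L : ℝ} (hL : 0 < L) (hbox : Ω ⊆ box d L) :
    ∃ S : Lp ℂ 2 (volume.restrict Ω) →ₗᵢ[ℂ] lp (fun _ : Fin d → ℤ => ℂ) 2,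
      ∀ f k, S f k = fourierCoef Ω L f k := by
  have hsum := fun f : Lp ℂ 2 (volume.restrict Ω) =>
    hasSum_sq_fourierCoef hΩ hL hbox (Lp.memLp f)
  have hmem : ∀ f : Lp ℂ 2 (volume.restrict Ω), Memℓp (fourierCoef Ω L f) 2 := fun f => by
    refine memℓp_gen ?_
    simpa using (hsum f).summable
  have hint : ∀ (f : Lp ℂ 2 (volume.restrict Ω)) (k : Fin d → ℤ), IntegrableOn (fun x =>
      Complex.exp (-(Complex.I * ∑ i, (freq L k i : ℂ) * (x i : ℂ))) * f x) Ω := fun f k =>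
    integrable_continuous_mul hΩb hΩ (integrable_of_memLp_two hΩb (Lp.memLp f))
      (continuous_exp_freq L k)
  let A : Lp ℂ 2 (volume.restrict Ω) →ₗ[ℂ] lp (fun _ : Fin d → ℤ => ℂ) 2 :=
    { toFun := fun f => ⟨fourierCoef Ω L f, hmem f⟩
      map_add' := fun f g => by
        ext k
        change fourierCoef Ω L _ k = fourierCoef Ω L f k + fourierCoef Ω L g k
        rw [fourierCoef_congr (Lp.coeFn_add f g)]
        simp only [fourierCoef, ← mul_add]
        rw [← integral_add (hint f k) (hint g k)]
        simp only [Pi.add_apply, mul_add]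
      map_smul' := fun a f => by
        ext k
        change fourierCoef Ω L _ k = a * fourierCoef Ω L f k
        rw [fourierCoef_congr (Lp.coeFn_smul a f)]
        simp only [fourierCoef, Pi.smul_apply, smul_eq_mul]
        simp only [mul_left_comm _ a, integral_const_mul] }
  refine ⟨⟨A, fun f => ?_⟩, fun f k => rfl⟩
  have h1 := lp.norm_rpow_eq_tsum (p := 2) (by norm_num) (A f)
  have h2 : ∑' k, ‖A f k‖ ^ 2 = ‖f‖ ^ 2 := ((hsum f).tsum_eq).trans (norm_sq_Lp_two f).symm
  simp only [ENNReal.toReal_ofNat, Real.rpow_two] at h1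
  rw [h2] at h1
  exact (sq_eq_sq₀ (norm_nonneg _) (norm_nonneg _)).1 h1

/-- The bilateral Laplace integral `∫_Ω u(x) e^{ζ·x} dx`. -/
def laplaceInt {d : ℕ} (Ω : Set (E d)) (ζ : Fin d → ℂ) (u : E d → ℝ) : ℂ :=
  ∫ x in Ω, Complex.exp (∑ i, ζ i * (x i : ℂ)) * (u x : ℂ)

/-- Parseval for `exp (η · x) u`: the real exponential merges with the characters into a complex
frequency. -/
theorem hasSum_sq_laplaceInt {d : ℕ} {Ω : Set (E d)} (hΩ : MeasurableSet Ω)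
    (hΩb : Bornology.IsBounded Ω) {L : ℝ} (hL : 0 < L) (hbox : Ω ⊆ box d L) (η : Fin d → ℝ)
    {u : E d → ℝ} (hu : MemLp u 2 (volume.restrict Ω)) :
    HasSum (fun k => (L ^ d)⁻¹ * ‖laplaceInt Ω (fun i => η i - Complex.I * freq L k i) u‖ ^ 2)
      (∫ x in Ω, (Real.exp (∑ i, η i * x i) * u x) ^ 2) := by
  have h1 : MemLp (fun x : E d => ((Real.exp (∑ i, η i * x i) * u x : ℝ) : ℂ)) 2
      (volume.restrict Ω) :=
    (memLp_continuous_mul hΩb hΩ hu (by fun_prop)).ofReal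
  convert hasSum_sq_fourierCoef hΩ hL hbox h1 using 2 with k
  · rw [fourierCoef, norm_mul, mul_pow, Complex.norm_real, Real.norm_eq_abs, sq_abs, inv_pow,
      Real.sq_sqrt (by positivity), laplaceInt]
    congr 4
    ext x
    push_cast
    rw [← mul_assoc, ← Complex.exp_add]
    congr 2
    simp only [Finset.mul_sum, ← Finset.sum_neg_distrib, ← Finset.sum_add_distrib]
    exact Finset.sum_congr rfl fun i _ => by ring
  · ext x
    rw [Complex.norm_real, Real.norm_eq_abs, sq_abs]

/-! ### Test functions and exponentials -/

lemma continuous_partialDeriv {d : ℕ} (i : Fin d) {φ : E d → ℝ} (hφ : ContDiff ℝ ∞ φ) :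
    Continuous (partialDeriv i φ) :=
  (hφ.continuous_fderiv (by simp)).clm_apply continuous_const

/-- Identities tested with compactly supported smooth functions on the whole space extend to all
smooth functions, since the domain is bounded. -/
lemma test_smooth {d : ℕ} {Ω : Set (E d)} (hΩ : MeasurableSet Ω) (hΩb : Bornology.IsBounded Ω)
    {g : Fin d → E d → ℝ} {h : E d → ℝ}
    (H : ∀ φ : E d → ℝ, ContDiff ℝ ∞ φ → HasCompactSupport φ →
      ∫ x in Ω, ((∑ i, g i x * partialDeriv i φ x) + h x * φ x) = 0)
    {ψ : E d → ℝ} (hψ : ContDiff ℝ ∞ ψ) :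
    ∫ x in Ω, ((∑ i, g i x * partialDeriv i ψ x) + h x * ψ x) = 0 := by
  obtain ⟨R, hR0, hR⟩ := hΩb.subset_ball_lt 0 (0 : E d)
  let χ : ContDiffBump (0 : E d) := ⟨R, R + 1, hR0, by linarith⟩
  have hχ : ContDiff ℝ ∞ fun x => χ x * ψ x := χ.contDiff.mul hψ
  rw [← H _ hχ χ.hasCompactSupport.mul_right]
  apply setIntegral_congr_fun hΩ
  intro x hx
  have h1 : (fun y => χ y * ψ y) =ᶠ[𝓝 x] ψ := by
    filter_upwards [Metric.isOpen_ball.mem_nhds (hR hx)] with y hy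
    rw [χ.one_of_mem_closedBall (Metric.ball_subset_closedBall hy), one_mul]
  simp only [partialDeriv, h1.fderiv_eq, h1.eq_of_nhds]

/-- The real and imaginary parts of `exp (ζ · x)` are admissible test functions, and differentiating
the exponential multiplies it by `ζ i`. -/
lemma test_exp {d : ℕ} {Ω : Set (E d)} (hΩ : MeasurableSet Ω) (hΩb : Bornology.IsBounded Ω)
    {g : Fin d → E d → ℝ} {h : E d → ℝ} (hg : ∀ i, IntegrableOn (g i) Ω) (hh : IntegrableOn h Ω)
    (H : ∀ φ : E d → ℝ, ContDiff ℝ ∞ φ → HasCompactSupport φ →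
      ∫ x in Ω, ((∑ i, g i x * partialDeriv i φ x) + h x * φ x) = 0)
    (ζ : Fin d → ℂ) : (∑ i, ζ i * laplaceInt Ω ζ (g i)) + laplaceInt Ω ζ h = 0 := by
  set e : E d → ℂ := fun x => Complex.exp (∑ i, ζ i * (x i : ℂ)) with he
  have hec : Continuous e := by fun_prop
  have hes : ContDiff ℝ ∞ e := by
    refine Complex.contDiff_exp.comp (ContDiff.sum fun i _ => contDiff_const.mul ?_)
    exact Complex.ofRealCLM.contDiff.comp (by fun_prop)
  have hint : ∀ {u : E d → ℝ}, IntegrableOn u Ω → IntegrableOn (fun x => e x * (u x : ℂ)) Ω :=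
    fun hu => integrable_continuous_mul hΩb hΩ hu.ofReal hec
  have hed : ∀ x i, fderiv ℝ e x (EuclideanSpace.single i 1) = ζ i * e x := fun x i => by
    have h1 : HasFDerivAt (fun x : E d => ∑ i, ζ i * (x i : ℂ))
        (∑ i, ζ i • (Complex.ofRealCLM.comp (EuclideanSpace.proj i : E d →L[ℝ] ℝ))) x := by
      refine HasFDerivAt.fun_sum fun i _ => ?_
      exact ((Complex.ofRealCLM.comp (EuclideanSpace.proj i : E d →L[ℝ] ℝ)).hasFDerivAt).const_mul (ζ i)
    rw [he, h1.cexp.fderiv]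
    simp [PiLp.single_apply, mul_comm, apply_ite Complex.ofReal]
  have hI : IntegrableOn (fun x => (∑ i, ζ i * (e x * (g i x : ℂ))) + e x * (h x : ℂ)) Ω :=
    (integrable_finsetSum _ fun i _ => (hint (hg i)).const_mul (ζ i)).add (hint hh)
  have hsum : (∑ i, ζ i * laplaceInt Ω ζ (g i)) + laplaceInt Ω ζ h =
      ∫ x in Ω, ((∑ i, ζ i * (e x * (g i x : ℂ))) + e x * (h x : ℂ)) := by
    rw [integral_add (integrable_finsetSum _ fun i _ => (hint (hg i)).const_mul (ζ i)) (hint hh),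
      integral_finsetSum _ fun i _ => (hint (hg i)).const_mul (ζ i)]
    simp only [integral_const_mul]
    rfl
  rw [hsum]
  have part : ∀ A : ℂ →L[ℝ] ℝ, A (∫ x in Ω, ((∑ i, ζ i * (e x * (g i x : ℂ))) + e x * (h x : ℂ)))
      = 0 := fun A => by
    rw [← A.integral_comp_comm hI, ← test_smooth hΩ hΩb H (A.contDiff.comp hes)]
    refine integral_congr_ae (ae_of_all _ fun x => ?_)
    have h2 : ∀ i, partialDeriv i (A ∘ e) x = A (ζ i * e x) := fun i => by
      rw [partialDeriv, (A.hasFDerivAt.comp x (hes.differentiable (by simp) x).hasFDerivAt).fderiv]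
      simp [hed]
    have h3 : ∀ (r : ℝ) (z : ℂ), A (z * (r : ℂ)) = r * A z := fun r z => by
      rw [mul_comm z, ← Complex.real_smul, map_smul, smul_eq_mul]
    simp only [h2, map_add, map_sum, ← mul_assoc, h3, Function.comp]
  exact Complex.ext (part Complex.reCLM) (part Complex.imCLM)

/-! ### Functions with vanishing Cauchy data -/

/-- The extensions by zero of `u`, `g` and `h` to the whole space satisfy `∇u = g` and
`div g = h`. -/
structure IsZeroTraceTriple {d : ℕ} (Ω : Set (E d)) (u : L2 Ω) (g : Fin d → L2 Ω) (h : L2 Ω) :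
    Prop where
  grad : ∀ φ : E d → ℝ, ContDiff ℝ ∞ φ → HasCompactSupport φ → ∀ i : Fin d,
    ∫ x in Ω, (u x * partialDeriv i φ x + g i x * φ x) = 0
  div : ∀ φ : E d → ℝ, ContDiff ℝ ∞ φ → HasCompactSupport φ →
    ∫ x in Ω, ((∑ i, g i x * partialDeriv i φ x) + h x * φ x) = 0

lemma laplaceInt_of_global_partial {d : ℕ} {Ω : Set (E d)} (hΩ : MeasurableSet Ω)
    (hΩb : Bornology.IsBounded Ω) {u v : E d → ℝ} (hu : IntegrableOn u Ω) (hv : IntegrableOn v Ω)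
    (i : Fin d) (H : ∀ φ : E d → ℝ, ContDiff ℝ ∞ φ → HasCompactSupport φ →
      ∫ x in Ω, (u x * partialDeriv i φ x + v x * φ x) = 0) (ζ : Fin d → ℂ) :
    laplaceInt Ω ζ v = -(ζ i * laplaceInt Ω ζ u) := by
  -- A partial derivative is the divergence of the field whose only nonzero component is `u`, in
  -- position `i`.
  have h1 : ∀ j, IntegrableOn ((fun j => if j = i then u else 0 : Fin d → E d → ℝ) j) Ω := by
    intro j
    by_cases hj : j = i
    · simpa [hj] using hu
    · simp only [hj, if_false]
      exact integrable_zero _ _ _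
  have h2 := test_exp hΩ hΩb h1 hv (fun φ hφ hc => by
    rw [← H φ hφ hc]
    congr 1
    ext x
    simp [ite_apply, ite_mul]) ζ
  have h3 : ∑ j, ζ j * laplaceInt Ω ζ (if j = i then u else 0) = ζ i * laplaceInt Ω ζ u := by
    rw [Finset.sum_eq_single i]
    · simp
    · intro j _ hj
      simp [hj, laplaceInt]
    · simp
  rw [h3] at h2
  linear_combination h2

lemma L2_integrable {d : ℕ} {Ω : Set (E d)} (hΩb : Bornology.IsBounded Ω) (u : L2 Ω) :
    IntegrableOn u Ω := integrable_of_memLp_two hΩb (Lp.memLp u)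

lemma IsZeroTraceTriple.laplaceInt_grad {d : ℕ} {Ω : Set (E d)} (hΩ : MeasurableSet Ω)
    (hΩb : Bornology.IsBounded Ω) {u : L2 Ω} {g : Fin d → L2 Ω} {h : L2 Ω}
    (H : IsZeroTraceTriple Ω u g h) (i : Fin d) (ζ : Fin d → ℂ) :
    laplaceInt Ω ζ (g i) = -(ζ i * laplaceInt Ω ζ u) :=
  laplaceInt_of_global_partial hΩ hΩb (L2_integrable hΩb u) (L2_integrable hΩb (g i)) i
    (fun φ hφ hc => H.grad φ hφ hc i) ζ

lemma IsZeroTraceTriple.laplaceInt_div {d : ℕ} {Ω : Set (E d)} (hΩ : MeasurableSet Ω)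
    (hΩb : Bornology.IsBounded Ω) {u : L2 Ω} {g : Fin d → L2 Ω} {h : L2 Ω}
    (H : IsZeroTraceTriple Ω u g h) (ζ : Fin d → ℂ) :
    laplaceInt Ω ζ h = (∑ i, ζ i ^ 2) * laplaceInt Ω ζ u := by
  have h1 := test_exp hΩ hΩb (fun i => L2_integrable hΩb (g i)) (L2_integrable hΩb h) H.div ζ
  simp only [H.laplaceInt_grad hΩ hΩb] at h1
  rw [Finset.sum_mul, eq_neg_of_add_eq_zero_right h1, ← Finset.sum_neg_distrib]
  exact Finset.sum_congr rfl fun i _ => by ring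

/-- This gap at zero is the reason for half-integer frequencies: `2 * k i + 1` is a nonzero integer.
-/
lemma pi_div_le_abs_freq {d : ℕ} {L : ℝ} (hL : 0 < L) (k : Fin d → ℤ) (i : Fin d) :
    Real.pi / L ≤ |freq L k i| := by
  have h1 : (1 : ℝ) ≤ |2 * (k i : ℝ) + 1| := by
    have : 1 ≤ |2 * k i + 1| := Int.one_le_abs (by omega)
    exact_mod_cast this
  have h2 : freq L k i = Real.pi / L * (2 * (k i : ℝ) + 1) := by
    unfold freq; ring
  have h3 : 0 < Real.pi / L := by positivity
  rw [h2, abs_mul, abs_of_pos h3]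
  nlinarith

/-- A Carleman estimate with linear weight. -/
theorem IsZeroTraceTriple.carleman {d : ℕ} {Ω : Set (E d)} (hΩ : MeasurableSet Ω)
    (hΩb : Bornology.IsBounded Ω) {L : ℝ} (hL : 0 < L) (hbox : Ω ⊆ box d L)
    {u : L2 Ω} {g : Fin d → L2 Ω} {h : L2 Ω} (H : IsZeroTraceTriple Ω u g h) (j : Fin d) {τ : ℝ}
    (hτ : 0 ≤ τ) :
    (2 * τ * (Real.pi / L)) ^ 2 * ∫ x in Ω, (Real.exp (τ * x j) * u x) ^ 2 ≤
      ∫ x in Ω, (Real.exp (τ * x j) * h x) ^ 2 := by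
  set η : Fin d → ℝ := Pi.single j τ with hη
  have hs : ∀ x : E d, ∑ i, η i * x i = τ * x j := fun x => by
    rw [Finset.sum_eq_single j] <;> simp +contextual [hη]
  have h1 := hasSum_sq_laplaceInt hΩ hΩb hL hbox η (Lp.memLp u)
  have h2 := hasSum_sq_laplaceInt hΩ hΩb hL hbox η (Lp.memLp h)
  simp only [hs] at h1 h2
  refine hasSum_le (fun k => ?_) (h1.mul_left _) h2
  set ζ : Fin d → ℂ := fun i => η i - Complex.I * freq L k i with hζ
  have h3 : 2 * τ * (Real.pi / L) ≤ ‖∑ i, ζ i ^ 2‖ := by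
    -- Only the `j`-th square has an imaginary part, the cross term of `τ` and the frequency.
    have him : (∑ i, ζ i ^ 2).im = -(2 * τ * freq L k j) := by
      rw [Complex.im_sum, Finset.sum_eq_single j]
      · simp [hζ, hη, pow_two]; ring
      · intro i _ hi
        simp [hζ, hη, hi, pow_two]
      · simp
    refine le_trans ?_ (Complex.abs_im_le_norm _)
    rw [him, abs_neg, abs_mul, abs_of_nonneg (by positivity)]
    exact mul_le_mul_of_nonneg_left (pi_div_le_abs_freq hL k j) (by positivity)
  rw [H.laplaceInt_div hΩ hΩb, norm_mul, mul_pow ‖_‖, mul_left_comm]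
  have : 0 ≤ 2 * τ * (Real.pi / L) := by positivity
  gcongr

/-- On the Fourier side, this says that the Laplacian controls every mixed second derivative. -/
lemma freq_mul_le {d : ℕ} (L : ℝ) (k : Fin d → ℤ) (i j : Fin d) :
    |freq L k i| * |freq L k j| ≤ ∑ l, freq L k l ^ 2 := by
  have hi := Finset.single_le_sum (f := fun l => freq L k l ^ 2) (fun l _ => sq_nonneg _)
    (Finset.mem_univ i)
  have hj := Finset.single_le_sum (f := fun l => freq L k l ^ 2) (fun l _ => sq_nonneg _)
    (Finset.mem_univ j)
  nlinarith [sq_nonneg (|freq L k i| - |freq L k j|), sq_abs (freq L k i), sq_abs (freq L k j)]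

lemma norm_sum_sq_freq {d : ℕ} (L : ℝ) (k : Fin d → ℤ) :
    ‖∑ i, ((0 : ℝ) - Complex.I * freq L k i) ^ 2‖ = ∑ i, freq L k i ^ 2 := by
  have : ∑ i, (((0 : ℝ) : ℂ) - Complex.I * freq L k i) ^ 2 = ((-∑ i, freq L k i ^ 2 : ℝ) : ℂ) := by
    push_cast
    rw [← Finset.sum_neg_distrib]
    refine Finset.sum_congr rfl fun i _ => ?_
    linear_combination ((freq L k i : ℂ) ^ 2) * Complex.I_sq
  rw [this, Complex.norm_real, norm_neg, Real.norm_of_nonneg]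
  exact Finset.sum_nonneg fun i _ => sq_nonneg _

/-- By Parseval with `η = 0`, it suffices that `π / L * |ξ_j| ≤ |ξ_j| ^ 2 ≤ |ξ| ^ 2` at every
frequency `ξ`. -/
theorem IsZeroTraceTriple.norm_grad_le {d : ℕ} {Ω : Set (E d)} (hΩ : MeasurableSet Ω)
    (hΩb : Bornology.IsBounded Ω) {L : ℝ} (hL : 0 < L) (hbox : Ω ⊆ box d L)
    {u : L2 Ω} {g : Fin d → L2 Ω} {h : L2 Ω} (H : IsZeroTraceTriple Ω u g h) (j : Fin d) :
    Real.pi / L * ‖g j‖ ≤ ‖h‖ := by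
  have h1 := hasSum_sq_laplaceInt hΩ hΩb hL hbox 0 (Lp.memLp (g j))
  have h2 := hasSum_sq_laplaceInt hΩ hΩb hL hbox 0 (Lp.memLp h)
  have h0 : 0 < Real.pi / L := by positivity
  have hn : ∀ w : L2 Ω, ‖w‖ ^ 2 = ∫ x in Ω, (w x) ^ 2 := fun w => by
    rw [norm_sq_Lp_two]; simp
  simp only [Pi.zero_apply, zero_mul, Finset.sum_const_zero, Real.exp_zero, one_mul, ← hn] at h1 h2
  refine le_of_sq_le_sq ?_ (norm_nonneg _)
  rw [mul_pow]
  refine hasSum_le (fun k => ?_) (h1.mul_left _) h2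
  rw [H.laplaceInt_div hΩ hΩb, H.laplaceInt_grad hΩ hΩb, norm_neg, norm_mul, norm_mul, mul_left_comm,
    norm_sum_sq_freq]
  have h3 : Real.pi / L * ‖((0 : ℝ) : ℂ) - Complex.I * freq L k j‖ ≤ ∑ i, freq L k i ^ 2 := by
    have : ‖((0 : ℝ) : ℂ) - Complex.I * freq L k j‖ = |freq L k j| := by simp
    rw [this]
    exact (mul_le_mul_of_nonneg_right (pi_div_le_abs_freq hL k j) (abs_nonneg _)).trans
      (freq_mul_le L k j j)
  rw [← mul_pow, ← mul_assoc]
  gcongr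

/-! ### Second derivatives -/

/-- Integration by parts without boundary terms. Here `ψ` need not have compact support, so a test
function supported in `Ω` satisfies the hypothesis of `laplaceInt_of_global_partial`. -/
lemma integral_partialDeriv_mul_of_tsupport_subset {d : ℕ} {Ω : Set (E d)} {φ ψ : E d → ℝ}
    (hφ : ContDiff ℝ ∞ φ) (hφc : HasCompactSupport φ) (hφΩ : tsupport φ ⊆ Ω) (hψ : ContDiff ℝ ∞ ψ)
    (j : Fin d) : ∫ x in Ω, (φ x * partialDeriv j ψ x + partialDeriv j φ x * ψ x) = 0 := by
  have hcd : HasCompactSupport (partialDeriv j φ) :=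
    hφc.fderiv_apply (𝕜 := ℝ) (EuclideanSpace.single j 1)
  have hsub : tsupport (partialDeriv j φ) ⊆ tsupport φ :=
    tsupport_fderiv_apply_subset ℝ (EuclideanSpace.single j 1)
  have i1 : Integrable fun x => φ x * partialDeriv j ψ x :=
    (hφ.continuous.mul (continuous_partialDeriv j hψ)).integrable_of_hasCompactSupport hφc.mul_right
  have i2 : Integrable fun x => partialDeriv j φ x * ψ x :=
    ((continuous_partialDeriv j hφ).mul hψ.continuous).integrable_of_hasCompactSupport
      hcd.mul_right
  have i3 : Integrable fun x => φ x * ψ x :=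
    (hφ.continuous.mul hψ.continuous).integrable_of_hasCompactSupport hφc.mul_right
  rw [setIntegral_eq_integral_of_forall_compl_eq_zero fun x hx => by
    have h1 : φ x = 0 := image_eq_zero_of_notMem_tsupport fun hx' => hx (hφΩ hx')
    have h2 : partialDeriv j φ x = 0 :=
      image_eq_zero_of_notMem_tsupport fun hx' => hx (hφΩ (hsub hx'))
    simp [h1, h2], integral_add i1 i2]
  have := integral_mul_fderiv_eq_neg_fderiv_mul_of_integrable i2 i1 i3
    (fun x _ => hφ.differentiable (by simp) x) (fun x _ => hψ.differentiable (by simp) x)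
  change ∫ x, φ x * partialDeriv j ψ x = -∫ x, partialDeriv j φ x * ψ x at this
  rw [this]; ring

lemma fourierCoef_ofReal {d : ℕ} (Ω : Set (E d)) (L : ℝ) (u : E d → ℝ) (k : Fin d → ℤ) :
    fourierCoef Ω L (fun x => (u x : ℂ)) k =
      ((√(L ^ d))⁻¹ : ℝ) * laplaceInt Ω (fun i => (0 : ℝ) - Complex.I * freq L k i) u := by
  unfold fourierCoef laplaceInt
  congr 2
  ext x
  congr 2
  rw [Finset.mul_sum, ← Finset.sum_neg_distrib]
  exact Finset.sum_congr rfl fun i _ => by push_cast; ring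

lemma memLp_of_continuous_compact {d : ℕ} {Ω : Set (E d)} {φ : E d → ℝ} (hφ : Continuous φ)
    (hc : HasCompactSupport φ) : MemLp φ 2 (volume.restrict Ω) :=
  (hφ.memLp_of_hasCompactSupport hc).restrict Ω

/-- A triple records only the Laplacian, while `MemH2` asks for every second derivative. The missing
ones are obtained by multiplying the Fourier coefficients of `g i` by `i ξ_j`; these products are
dominated by the coefficients of `h`, hence square summable. -/
theorem IsZeroTraceTriple.exists_hasWeakPartial {d : ℕ} {Ω : Set (E d)} (hΩ : MeasurableSet Ω)
    (hΩb : Bornology.IsBounded Ω) {L : ℝ} (hL : 0 < L) (hbox : Ω ⊆ box d L)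
    {u : L2 Ω} {g : Fin d → L2 Ω} {h : L2 Ω} (H : IsZeroTraceTriple Ω u g h) (i j : Fin d) :
    ∃ v : L2 Ω, HasWeakPartial Ω j (g i) v := by
  obtain ⟨S, hS⟩ := exists_fourierIsometry hΩ hΩb hL hbox
  have cplx : ∀ w : E d → ℝ, MemLp w 2 (volume.restrict Ω) →
      ∃ W : Lp ℂ 2 (volume.restrict Ω), (W =ᵐ[volume.restrict Ω] fun x => (w x : ℂ)) ∧
        ∀ k, S W k = ((√(L ^ d))⁻¹ : ℝ) *
          laplaceInt Ω (fun i => (0 : ℝ) - Complex.I * freq L k i) w := fun w hw =>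
    ⟨hw.ofReal.toLp _, hw.ofReal.coeFn_toLp, fun k => by
      rw [hS, ← fourierCoef_ofReal]; exact fourierCoef_congr hw.ofReal.coeFn_toLp k⟩
  obtain ⟨G, hG, hSG⟩ := cplx (g i) (Lp.memLp _)
  obtain ⟨D, hD, hSD⟩ := cplx h (Lp.memLp _)
  set a : (Fin d → ℤ) → ℂ := fun k => Complex.I * freq L k j * S G k with ha
  have hale : ∀ k, ‖a k‖ ≤ ‖S D k‖ := fun k => by
    simp only [ha]
    rw [hSG, hSD, H.laplaceInt_div hΩ hΩb, H.laplaceInt_grad hΩ hΩb, norm_mul, norm_mul, norm_mul,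
      norm_mul, norm_mul, norm_sum_sq_freq, norm_neg, norm_mul, Complex.norm_I, one_mul,
      Complex.norm_real, Real.norm_eq_abs]
    have h1 : ‖((0 : ℝ) : ℂ) - Complex.I * freq L k i‖ = |freq L k i| := by simp
    rw [h1]
    have h2 := freq_mul_le L k j i
    calc _ = ‖(((√(L ^ d))⁻¹ : ℝ) : ℂ)‖ * ((|freq L k j| * |freq L k i|) *
          ‖laplaceInt Ω (fun i => (0 : ℝ) - Complex.I * freq L k i) u‖) := by ring
      _ ≤ _ := by gcongr
  have hmem : Memℓp a 2 := (lp.memℓp (S D)).mono' hale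
  set A : lp (fun _ : Fin d → ℤ => ℂ) 2 := ⟨a, hmem⟩ with hA
  -- `S` is used only as an isometric embedding, so `A` need not lie in its range. The adjoint
  -- suffices, since a weak derivative is only paired with test functions.
  set V := S.toContinuousLinearMap.adjoint A with hV
  have hVm : MemLp (fun x => (V x).re) 2 (volume.restrict Ω) := (Lp.memLp V).re
  refine ⟨hVm.toLp _, fun φ hφ hc hφΩ => ?_⟩
  have hcd : HasCompactSupport (partialDeriv j φ) :=
    hc.fderiv_apply (𝕜 := ℝ) (EuclideanSpace.single j 1)
  have m1 : MemLp φ 2 (volume.restrict Ω) := memLp_of_continuous_compact hφ.continuous hc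
  have m2 : MemLp (partialDeriv j φ) 2 (volume.restrict Ω) :=
    memLp_of_continuous_compact (continuous_partialDeriv j hφ) hcd
  obtain ⟨Φ, hΦ, hSΦ⟩ := cplx φ m1
  obtain ⟨Φ', hΦ', hSΦ'⟩ := cplx (partialDeriv j φ) m2
  have hder : ∀ k, S Φ' k = Complex.I * freq L k j * S Φ k := fun k => by
    rw [hSΦ, hSΦ', laplaceInt_of_global_partial hΩ hΩb (integrable_of_memLp_two hΩb m1)
      (integrable_of_memLp_two hΩb m2) j (fun ψ hψ _ =>
        integral_partialDeriv_mul_of_tsupport_subset hφ hc hφΩ hψ j)]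
    push_cast
    ring
  have hin : inner ℂ G Φ' = -inner ℂ V Φ := by
    rw [hV, ContinuousLinearMap.adjoint_inner_left, ← S.inner_map_map G Φ']
    have hk : ∀ k, inner ℂ (S G k) (S Φ' k) = -inner ℂ (A k) (S Φ k) := fun k => by
      rw [hder]
      simp only [hA, ha, RCLike.inner_apply, map_mul, Complex.conj_I, Complex.conj_ofReal]
      ring
    have hs := lp.hasSum_inner (𝕜 := ℂ) (S G) (S Φ')
    simp only [hk] at hs
    exact hs.unique (lp.hasSum_inner (𝕜 := ℂ) A (S Φ)).neg
  rw [L2.inner_def, L2.inner_def] at hin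
  have hre := congrArg Complex.re hin
  have e1 : ∫ x in Ω, inner ℂ (G x) (Φ' x) = ((∫ x in Ω, g i x * partialDeriv j φ x : ℝ) : ℂ) := by
    rw [← integral_complex_ofReal]
    apply integral_congr_ae
    filter_upwards [hG, hΦ'] with x h1 h2
    rw [h1, h2]
    simp [mul_comm]
  have e2 : (∫ x in Ω, inner ℂ (V x) (Φ x)).re = ∫ x in Ω, hVm.toLp _ x * φ x := by
    have := integral_re (L2.integrable_inner (𝕜 := ℂ) V Φ)
    simp only [RCLike.re_to_complex] at this
    rw [← this]
    apply integral_congr_ae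
    filter_upwards [hΦ, hVm.coeFn_toLp] with x h1 h2
    rw [h1, h2]
    simp [mul_comm]
  rw [e1, Complex.neg_re, e2, Complex.ofReal_re] at hre
  exact hre

/-! ### Calculus of weak derivatives -/

open Classical in
/-- The continuous functional `u ↦ ∫_Ω u φ` on `L²(Ω)` (zero if `φ ∉ L²(Ω)`). -/
def pairing {d : ℕ} (Ω : Set (E d)) (φ : E d → ℝ) : L2 Ω →L[ℝ] ℝ :=
  if h : MemLp φ 2 (volume.restrict Ω) then innerSL ℝ (h.toLp φ) else 0

lemma pairing_apply {d : ℕ} {Ω : Set (E d)} {φ : E d → ℝ} (h : MemLp φ 2 (volume.restrict Ω))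
    (u : L2 Ω) : pairing Ω φ u = ∫ x in Ω, u x * φ x := by
  rw [pairing, dif_pos h, innerSL_apply_apply, L2.inner_def]
  apply integral_congr_ae
  filter_upwards [h.coeFn_toLp] with x hx
  simp [hx]

lemma integrable_mul_test {d : ℕ} {Ω : Set (E d)} {φ : E d → ℝ}
    (h : MemLp φ 2 (volume.restrict Ω)) (u : L2 Ω) : IntegrableOn (fun x => u x * φ x) Ω :=
  (Lp.memLp u).integrable_mul h

lemma memLp_test {d : ℕ} (Ω : Set (E d)) {φ : E d → ℝ} (hφ : ContDiff ℝ ∞ φ)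
    (hc : HasCompactSupport φ) : MemLp φ 2 (volume.restrict Ω) :=
  memLp_of_continuous_compact hφ.continuous hc

lemma memLp_partialDeriv {d : ℕ} (Ω : Set (E d)) {φ : E d → ℝ} (hφ : ContDiff ℝ ∞ φ)
    (hc : HasCompactSupport φ) (i : Fin d) : MemLp (partialDeriv i φ) 2 (volume.restrict Ω) :=
  memLp_of_continuous_compact (continuous_partialDeriv i hφ)
    (hc.fderiv_apply (𝕜 := ℝ) (EuclideanSpace.single i 1))

lemma integral_eq_pairing_grad {d : ℕ} {Ω : Set (E d)} {φ : E d → ℝ} (hφ : ContDiff ℝ ∞ φ)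
    (hc : HasCompactSupport φ) (u v : L2 Ω) (i : Fin d) :
    ∫ x in Ω, (u x * partialDeriv i φ x + v x * φ x) =
      pairing Ω (partialDeriv i φ) u + pairing Ω φ v := by
  have h1 := memLp_test Ω hφ hc
  have h2 := memLp_partialDeriv Ω hφ hc i
  rw [pairing_apply h1, pairing_apply h2,
    integral_add (integrable_mul_test h2 u) (integrable_mul_test h1 v)]

lemma integral_eq_pairing_div {d : ℕ} {Ω : Set (E d)} {φ : E d → ℝ} (hφ : ContDiff ℝ ∞ φ)
    (hc : HasCompactSupport φ) (g : Fin d → L2 Ω) (h : L2 Ω) :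
    ∫ x in Ω, ((∑ i, g i x * partialDeriv i φ x) + h x * φ x) =
      (∑ i, pairing Ω (partialDeriv i φ) (g i)) + pairing Ω φ h := by
  have h1 := memLp_test Ω hφ hc
  have h2 := memLp_partialDeriv Ω hφ hc
  have h3 := fun i => integrable_mul_test (h2 i) (g i)
  rw [pairing_apply h1, integral_add (integrable_finsetSum _ fun i _ => h3 i)
    (integrable_mul_test h1 h), integral_finsetSum _ fun i _ => h3 i]
  simp only [fun i => pairing_apply (h2 i) (g i)]

lemma hasWeakPartial_iff {d : ℕ} {Ω : Set (E d)} {i : Fin d} {u v : L2 Ω} :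
    HasWeakPartial Ω i u v ↔ ∀ φ : E d → ℝ, ContDiff ℝ ∞ φ → HasCompactSupport φ → tsupport φ ⊆ Ω →
      pairing Ω (partialDeriv i φ) u = -pairing Ω φ v := by
  refine forall_congr' fun φ => forall_congr' fun hφ => forall_congr' fun hc => forall_congr' fun _ =>
    ?_
  rw [pairing_apply (memLp_test Ω hφ hc), pairing_apply (memLp_partialDeriv Ω hφ hc i)]

/-- In terms of continuous functionals, linearity and closedness of the condition become immediate.
-/
lemma isZeroTraceTriple_iff {d : ℕ} {Ω : Set (E d)} {u : L2 Ω} {g : Fin d → L2 Ω} {h : L2 Ω} :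
    IsZeroTraceTriple Ω u g h ↔ ∀ φ : E d → ℝ, ContDiff ℝ ∞ φ → HasCompactSupport φ →
      (∀ i, pairing Ω (partialDeriv i φ) u + pairing Ω φ (g i) = 0) ∧
      (∑ i, pairing Ω (partialDeriv i φ) (g i)) + pairing Ω φ h = 0 := by
  refine ⟨fun H φ hφ hc => ⟨fun i => ?_, ?_⟩, fun H => ⟨fun φ hφ hc i => ?_, fun φ hφ hc => ?_⟩⟩
  · rw [← integral_eq_pairing_grad hφ hc]; exact H.grad φ hφ hc i
  · rw [← integral_eq_pairing_div hφ hc]; exact H.div φ hφ hc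
  · rw [integral_eq_pairing_grad hφ hc]; exact (H φ hφ hc).1 i
  · rw [integral_eq_pairing_div hφ hc]; exact (H φ hφ hc).2

/-- The fundamental lemma of the calculus of variations; it makes weak derivatives unique, so that
the choice in `weakPartial` is harmless. -/
lemma L2_eq_of_pairing_eq {d : ℕ} {Ω : Set (E d)} (hΩ : IsOpen Ω) (hΩb : Bornology.IsBounded Ω)
    {v w : L2 Ω} (H : ∀ φ : E d → ℝ, ContDiff ℝ ∞ φ → HasCompactSupport φ → tsupport φ ⊆ Ω →
      pairing Ω φ v = pairing Ω φ w) : v = w := by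
  rw [← sub_eq_zero]
  have h0 := hΩ.ae_eq_zero_of_integral_contDiff_smul_eq_zero (μ := volume) (f := (v - w : L2 Ω))
    (L2_integrable hΩb (v - w)).locallyIntegrableOn fun φ hφ hc hs => by
      have h1 := pairing_apply (memLp_test Ω hφ hc) (v - w)
      rw [map_sub, H φ hφ hc hs, sub_self] at h1
      rw [← setIntegral_eq_integral_of_forall_compl_eq_zero (s := Ω) fun x hx => by
        rw [image_eq_zero_of_notMem_tsupport fun hx' => hx (hs hx'), zero_smul], h1]
      exact integral_congr_ae (ae_of_all _ fun x => mul_comm _ _)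
  apply Lp.ext
  refine Filter.EventuallyEq.trans ?_ (Lp.coeFn_zero ℝ 2 (volume.restrict Ω)).symm
  rw [Filter.EventuallyEq, ae_restrict_iff' hΩ.measurableSet]
  exact h0

lemma HasWeakPartial.weakPartial_eq {d : ℕ} {Ω : Set (E d)} (hΩ : IsOpen Ω)
    (hΩb : Bornology.IsBounded Ω) {i : Fin d} {u v : L2 Ω} (h : HasWeakPartial Ω i u v) :
    weakPartial Ω i u = v := by
  have hex : ∃ v, HasWeakPartial Ω i u v := ⟨v, h⟩
  rw [weakPartial, dif_pos hex]
  refine L2_eq_of_pairing_eq hΩ hΩb fun φ hφ hc hs => ?_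
  have h1 := hasWeakPartial_iff.1 hex.choose_spec φ hφ hc hs
  have h2 := hasWeakPartial_iff.1 h φ hφ hc hs
  linarith

lemma HasWeakPartial.add {d : ℕ} {Ω : Set (E d)} {i : Fin d} {u v u' v' : L2 Ω}
    (h : HasWeakPartial Ω i u v) (h' : HasWeakPartial Ω i u' v') :
    HasWeakPartial Ω i (u + u') (v + v') := by
  rw [hasWeakPartial_iff] at *
  intro φ hφ hc hs
  rw [map_add, map_add, h φ hφ hc hs, h' φ hφ hc hs]
  ring

lemma MemH2.hasWeakPartial {d : ℕ} {Ω : Set (E d)} (hΩ : IsOpen Ω) (hΩb : Bornology.IsBounded Ω)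
    {u : L2 Ω} (hu : MemH2 Ω u) (i : Fin d) : HasWeakPartial Ω i u (weakPartial Ω i u) := by
  obtain ⟨g, hg, -⟩ := hu
  rw [(hg i).weakPartial_eq hΩ hΩb]
  exact hg i

lemma MemH2.hasWeakPartial_weakPartial {d : ℕ} {Ω : Set (E d)} (hΩ : IsOpen Ω)
    (hΩb : Bornology.IsBounded Ω) {u : L2 Ω} (hu : MemH2 Ω u) (i j : Fin d) :
    HasWeakPartial Ω j (weakPartial Ω i u) (weakPartial Ω j (weakPartial Ω i u)) := by
  obtain ⟨g, hg, hgg⟩ := hu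
  obtain ⟨h, hh⟩ := hgg i j
  rw [(hg i).weakPartial_eq hΩ hΩb, hh.weakPartial_eq hΩ hΩb]
  exact hh

lemma MemH2.add {d : ℕ} {Ω : Set (E d)} {u v : L2 Ω} (hu : MemH2 Ω u) (hv : MemH2 Ω v) :
    MemH2 Ω (u + v) := by
  obtain ⟨g, hg, hgg⟩ := hu
  obtain ⟨g', hg', hgg'⟩ := hv
  refine ⟨fun i => g i + g' i, fun i => (hg i).add (hg' i), fun i j => ?_⟩
  obtain ⟨h, hh⟩ := hgg i j
  obtain ⟨h', hh'⟩ := hgg' i j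
  exact ⟨h + h', hh.add hh'⟩

section Linearity

variable {d : ℕ} {Ω : Set (E d)} (hΩ : IsOpen Ω) (hΩb : Bornology.IsBounded Ω) {u v : L2 Ω}
  (hu : MemH2 Ω u) (hv : MemH2 Ω v)

include hΩ hΩb hu hv

lemma weakPartial_add (i : Fin d) :
    weakPartial Ω i (u + v) = weakPartial Ω i u + weakPartial Ω i v :=
  ((hu.hasWeakPartial hΩ hΩb i).add (hv.hasWeakPartial hΩ hΩb i)).weakPartial_eq hΩ hΩb

lemma weakLaplacian_add : weakLaplacian Ω (u + v) = weakLaplacian Ω u + weakLaplacian Ω v := by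
  simp only [weakLaplacian, ← Finset.sum_add_distrib, weakPartial_add hΩ hΩb hu hv]
  exact Finset.sum_congr rfl fun i _ => ((hu.hasWeakPartial_weakPartial hΩ hΩb i i).add
    (hv.hasWeakPartial_weakPartial hΩ hΩb i i)).weakPartial_eq hΩ hΩb

end Linearity

/-- The boundary integrals in the two Gauss–Green formulas coincide and cancel, so no trace theory
is involved. -/
lemma isZeroTraceTriple_sub {d : ℕ} {Ω : Set (E d)} {u v : L2 Ω} {f g : E d → ℝ}
    (hfu : HasDirichletTrace Ω u f)
    (hgu : HasNeumannTrace Ω u g) (hfv : HasDirichletTrace Ω v f) (hgv : HasNeumannTrace Ω v g) :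
    IsZeroTraceTriple Ω (u - v) (fun i => weakPartial Ω i u - weakPartial Ω i v)
      (weakLaplacian Ω u - weakLaplacian Ω v) := by
  rw [isZeroTraceTriple_iff]
  intro φ hφ hc
  constructor
  · intro i
    have h1 := (hfu φ hφ hc i).trans (hfv φ hφ hc i).symm
    rw [integral_eq_pairing_grad hφ hc, integral_eq_pairing_grad hφ hc] at h1
    rw [map_sub, map_sub]
    linarith
  · have h1 := (hgu φ hφ hc).trans (hgv φ hφ hc).symm
    rw [integral_eq_pairing_div hφ hc (fun i => weakPartial Ω i u),
      integral_eq_pairing_div hφ hc (fun i => weakPartial Ω i v)] at h1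
    simp only [map_sub, Finset.sum_sub_distrib]
    linarith

/-! ### Perturbing an `H²` function by one with vanishing Cauchy data. -/

section ZeroTrace

variable {d : ℕ} {Ω : Set (E d)} (hΩ : IsOpen Ω) (hΩb : Bornology.IsBounded Ω)
  {w : L2 Ω} {g : Fin d → L2 Ω} {h : L2 Ω} (H : IsZeroTraceTriple Ω w g h)

include H in
lemma IsZeroTraceTriple.hasWeakPartial (i : Fin d) : HasWeakPartial Ω i w (g i) := by
  rw [hasWeakPartial_iff]
  intro φ hφ hc _
  linarith [(isZeroTraceTriple_iff.1 H φ hφ hc).1 i]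

lemma exists_box (hΩb : Bornology.IsBounded Ω) : ∃ L > 0, Ω ⊆ box d L := by
  obtain ⟨R, hR0, hR⟩ := hΩb.subset_ball_lt 0 (0 : E d)
  refine ⟨2 * R, by positivity, fun x hx i => ?_⟩
  have h1 : ‖x‖ < R := by simpa using hR hx
  have h2 := (PiLp.norm_apply_le x i).trans_lt h1
  rw [Real.norm_eq_abs, abs_lt] at h2
  constructor <;> linarith [h2.1, h2.2]

include hΩ hΩb H

lemma IsZeroTraceTriple.memH2 : MemH2 Ω w := by
  obtain ⟨L, hL, hbox⟩ := exists_box hΩb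
  exact ⟨g, H.hasWeakPartial, H.exists_hasWeakPartial hΩ.measurableSet hΩb hL hbox⟩

lemma IsZeroTraceTriple.weakPartial_eq (i : Fin d) : weakPartial Ω i w = g i :=
  (H.hasWeakPartial i).weakPartial_eq hΩ hΩb

/-- Test functions supported in `Ω` see both the global divergence identity and the second weak
derivatives; comparing the two identifies `h`. -/
lemma IsZeroTraceTriple.weakLaplacian_eq : weakLaplacian Ω w = h := by
  refine L2_eq_of_pairing_eq hΩ hΩb fun φ hφ hc hs => ?_
  have h1 := (isZeroTraceTriple_iff.1 H φ hφ hc).2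
  have h2 := fun i => hasWeakPartial_iff.1
    ((H.memH2 hΩ hΩb).hasWeakPartial_weakPartial hΩ hΩb i i) φ hφ hc hs
  simp only [H.weakPartial_eq hΩ hΩb] at h2
  simp only [h2, Finset.sum_neg_distrib] at h1
  simp only [weakLaplacian, map_sum, H.weakPartial_eq hΩ hΩb]
  linarith

lemma IsZeroTraceTriple.hasDirichletTrace_add {u : L2 Ω} (hu : MemH2 Ω u) {f : E d → ℝ}
    (hf : HasDirichletTrace Ω u f) : HasDirichletTrace Ω (u + w) f := by
  intro φ hφ hc i
  rw [← hf φ hφ hc i, integral_eq_pairing_grad hφ hc, integral_eq_pairing_grad hφ hc,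
    weakPartial_add hΩ hΩb hu (H.memH2 hΩ hΩb), H.weakPartial_eq hΩ hΩb, map_add, map_add]
  linarith [(isZeroTraceTriple_iff.1 H φ hφ hc).1 i]

lemma IsZeroTraceTriple.hasNeumannTrace_add {u : L2 Ω} (hu : MemH2 Ω u) {f : E d → ℝ}
    (hf : HasNeumannTrace Ω u f) : HasNeumannTrace Ω (u + w) f := by
  intro φ hφ hc
  rw [← hf φ hφ hc, integral_eq_pairing_div hφ hc (fun i => weakPartial Ω i (u + w)),
    integral_eq_pairing_div hφ hc (fun i => weakPartial Ω i u)]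
  simp only [weakPartial_add hΩ hΩb hu (H.memH2 hΩ hΩb), H.weakPartial_eq hΩ hΩb, map_add,
    weakLaplacian_add hΩ hΩb hu (H.memH2 hΩ hΩb), H.weakLaplacian_eq hΩ hΩb,
    Finset.sum_add_distrib]
  linarith [(isZeroTraceTriple_iff.1 H φ hφ hc).2]

end ZeroTrace

/-! ### Multiplication operators -/

open Classical in
/-- Multiplication by `a` on `L²(Ω)` (zero if `a` is not essentially bounded). -/
def mulL {d : ℕ} (Ω : Set (E d)) (a : E d → ℝ) : L2 Ω →L[ℝ] L2 Ω :=
  if h : MemLp a ⊤ (volume.restrict Ω) then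
    (ContinuousLinearMap.mul ℝ ℝ).holderL (volume.restrict Ω) ⊤ 2 2 (h.toLp a) else 0

lemma mulL_ae {d : ℕ} {Ω : Set (E d)} (hΩ : MeasurableSet Ω) (hΩb : Bornology.IsBounded Ω)
    {a : E d → ℝ} (ha : Continuous a) (u : L2 Ω) :
    mulL Ω a u =ᵐ[volume.restrict Ω] fun x => a x * u x := by
  have h : MemLp a ⊤ (volume.restrict Ω) := by
    obtain ⟨C, hC⟩ := (hΩb.isCompact_closure.image ha.norm).isBounded.bddAbove
    refine memLp_top_of_bound ha.aestronglyMeasurable C ?_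
    filter_upwards [ae_restrict_mem hΩ] with x hx
    exact hC ⟨x, subset_closure hx, rfl⟩
  rw [mulL, dif_pos h]
  filter_upwards [(ContinuousLinearMap.mul ℝ ℝ).coeFn_holder (r := 2) (h.toLp a) u,
    h.coeFn_toLp] with x h1 h2
  refine h1.trans ?_
  rw [h2, ContinuousLinearMap.mul_apply']

lemma mulL_mulL {d : ℕ} {Ω : Set (E d)} (hΩ : MeasurableSet Ω) (hΩb : Bornology.IsBounded Ω)
    {a b : E d → ℝ} (ha : Continuous a) (hb : Continuous b) (u : L2 Ω) :
    mulL Ω a (mulL Ω b u) = mulL Ω (a * b) u := by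
  apply Lp.ext
  filter_upwards [mulL_ae hΩ hΩb ha (mulL Ω b u), mulL_ae hΩ hΩb hb u,
    mulL_ae hΩ hΩb (ha.mul hb) u] with x h1 h2 h3
  rw [h1, h2, h3, Pi.mul_apply, mul_assoc]

lemma mulL_comm {d : ℕ} {Ω : Set (E d)} (hΩ : MeasurableSet Ω) (hΩb : Bornology.IsBounded Ω)
    {a b : E d → ℝ} (ha : Continuous a) (hb : Continuous b) (u : L2 Ω) :
    mulL Ω a (mulL Ω b u) = mulL Ω b (mulL Ω a u) := by
  rw [mulL_mulL hΩ hΩb ha hb, mulL_mulL hΩ hΩb hb ha]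
  rw [mul_comm a b]

lemma norm_le_norm_mulL {d : ℕ} {Ω : Set (E d)} (hΩ : MeasurableSet Ω) (hΩb : Bornology.IsBounded Ω)
    {a : E d → ℝ} (ha : Continuous a) (ha0 : ∀ x, a x ≠ 0) (u : L2 Ω) :
    ‖u‖ ≤ ‖mulL Ω a⁻¹‖ * ‖mulL Ω a u‖ := by
  have h1 : mulL Ω a⁻¹ (mulL Ω a u) = u := by
    rw [mulL_mulL hΩ hΩb (ha.inv₀ ha0) ha]
    apply Lp.ext
    filter_upwards [mulL_ae hΩ hΩb ((ha.inv₀ ha0).mul ha) u] with x h1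
    rw [h1, Pi.mul_apply, Pi.inv_apply, inv_mul_cancel₀ (ha0 x), one_mul]
  calc ‖u‖ = ‖mulL Ω a⁻¹ (mulL Ω a u)‖ := by rw [h1]
    _ ≤ _ := ContinuousLinearMap.le_opNorm _ _

lemma norm_sq_mulL {d : ℕ} {Ω : Set (E d)} (hΩ : MeasurableSet Ω) (hΩb : Bornology.IsBounded Ω)
    {a : E d → ℝ} (ha : Continuous a) (u : L2 Ω) :
    ‖mulL Ω a u‖ ^ 2 = ∫ x in Ω, (a x * u x) ^ 2 := by
  rw [norm_sq_Lp_two]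
  apply integral_congr_ae
  filter_upwards [mulL_ae hΩ hΩb ha u] with x h1
  rw [h1, Real.norm_eq_abs, sq_abs]

/-! ### Minimization -/

/-- The lower bound makes `B` injective with complete range, so `y` can be projected onto it. Only
the target has to be a Hilbert space: the triples carry a supremum norm. -/
theorem exists_unique_norm_minimizer {X K : Type*} [NormedAddCommGroup X] [NormedSpace ℝ X]
    [CompleteSpace X] [NormedAddCommGroup K] [InnerProductSpace ℝ K] (B : X →L[ℝ] K) (C : ℝ)
    (hB : ∀ z, ‖z‖ ≤ C * ‖B z‖) (y : K) :
    ∃ z, ∀ z', ‖B z + y‖ ≤ ‖B z' + y‖ ∧ (‖B z' + y‖ ≤ ‖B z + y‖ → z' = z) := by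
  have hanti : AntilipschitzWith C.toNNReal B :=
    ContinuousLinearMap.antilipschitz_of_bound B fun z => (hB z).trans
      (mul_le_mul_of_nonneg_right (Real.le_coe_toNNReal C) (norm_nonneg _))
  have hcl : IsComplete (LinearMap.range B.toLinearMap : Set K) := by
    rw [LinearMap.coe_range]
    exact hanti.isComplete_range B.uniformContinuous
  have : CompleteSpace (LinearMap.range B.toLinearMap) := hcl.completeSpace_coe
  obtain ⟨p, ⟨z, hz⟩, q, hq, hpq⟩ :=
    Submodule.exists_add_mem_mem_orthogonal (K := LinearMap.range B.toLinearMap) y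
  -- Pythagoras: `B z` is the projection of `y` and `q` is orthogonal to the range, so the minimum
  -- is at `-z`.
  have key : ∀ z', ‖B z' + y‖ ^ 2 = ‖B (z' + z)‖ ^ 2 + ‖q‖ ^ 2 := fun z' => by
    have h1 : B z' + y = B (z' + z) + q := by
      rw [map_add, hpq, ← hz]
      simp [add_assoc]
    have h2 : inner ℝ (B (z' + z)) q = 0 := hq _ ⟨z' + z, rfl⟩
    rw [h1, norm_add_sq_real, h2]
    ring
  have key0 : ‖B (-z) + y‖ ^ 2 = ‖q‖ ^ 2 := by rw [key]; simp
  refine ⟨-z, fun z' => ⟨?_, fun h => ?_⟩⟩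
  · refine le_of_sq_le_sq ?_ (norm_nonneg _)
    rw [key0, key z']
    linarith [sq_nonneg ‖B (z' + z)‖]
  · have h1 : ‖B z' + y‖ ^ 2 ≤ ‖B (-z) + y‖ ^ 2 := by gcongr
    rw [key0, key z'] at h1
    have h2 : ‖B (z' + z)‖ = 0 := by
      have := sq_nonneg ‖B (z' + z)‖
      exact pow_eq_zero_iff (two_ne_zero) |>.1 (by linarith)
    have h3 := hB (z' + z)
    rw [h2, mul_zero] at h3
    exact eq_neg_of_add_eq_zero_left (norm_le_zero_iff.1 h3)

/-! ### The closed space of triples and the operator of the system -/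

/-- The space of triples `(u, ∇u, Δu)`. -/
abbrev Triple {d : ℕ} (Ω : Set (E d)) : Type := L2 Ω × (Fin d → L2 Ω) × L2 Ω

/-- The triples `(u, ∇u, Δu)` with vanishing Cauchy data. -/
def zeroTraceSubmodule {d : ℕ} (Ω : Set (E d)) : Submodule ℝ (Triple Ω) where
  carrier := {p | IsZeroTraceTriple Ω p.1 p.2.1 p.2.2}
  zero_mem' := isZeroTraceTriple_iff.2 fun φ _ _ => by simp
  add_mem' {p q} hp hq := isZeroTraceTriple_iff.2 fun φ hφ hc => by
    have h1 := isZeroTraceTriple_iff.1 hp φ hφ hc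
    have h2 := isZeroTraceTriple_iff.1 hq φ hφ hc
    refine ⟨fun i => ?_, ?_⟩
    · simp only [Prod.fst_add, Prod.snd_add, Pi.add_apply, map_add]
      linarith [h1.1 i, h2.1 i]
    · simp only [Prod.fst_add, Prod.snd_add, Pi.add_apply, map_add, Finset.sum_add_distrib]
      linarith [h1.2, h2.2]
  smul_mem' a p hp := isZeroTraceTriple_iff.2 fun φ hφ hc => by
    have h1 := isZeroTraceTriple_iff.1 hp φ hφ hc
    refine ⟨fun i => ?_, ?_⟩
    · simp only [Prod.smul_fst, Prod.smul_snd, Pi.smul_apply, map_smul, smul_eq_mul, ← mul_add,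
        h1.1 i, mul_zero]
    · simp only [Prod.smul_fst, Prod.smul_snd, Pi.smul_apply, map_smul, smul_eq_mul, ← Finset.mul_sum,
        ← mul_add, h1.2, mul_zero]

lemma isClosed_zeroTraceSubmodule {d : ℕ} (Ω : Set (E d)) :
    IsClosed (zeroTraceSubmodule Ω : Set (Triple Ω)) := by
  have : (zeroTraceSubmodule Ω : Set (Triple Ω)) =
      {p | ∀ φ : E d → ℝ, ContDiff ℝ ∞ φ → HasCompactSupport φ →
        (∀ i, pairing Ω (partialDeriv i φ) p.1 + pairing Ω φ (p.2.1 i) = 0) ∧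
        (∑ i, pairing Ω (partialDeriv i φ) (p.2.1 i)) + pairing Ω φ p.2.2 = 0} :=
    Set.ext fun p => isZeroTraceTriple_iff
  rw [this]
  simp only [ofPred_forall, ofPred_and]
  refine isClosed_iInter fun φ => isClosed_iInter fun _ => isClosed_iInter fun _ =>
    (isClosed_iInter fun i => ?_).inter ?_
  · exact isClosed_eq (by fun_prop) continuous_const
  · exact isClosed_eq (by fun_prop) continuous_const

/-- The operator `z ↦ (ρ (Δu_m - c ∑ₙ s_{mn} uₙ))_m`. -/
def systemOp {d N : ℕ} (Ω : Set (E d)) (ρ c : E d → ℝ) (s : Fin N → Fin N → ℝ) :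
    (Fin N → Triple Ω) →L[ℝ] PiLp 2 (fun _ : Fin N => L2 Ω) :=
  (PiLp.continuousLinearEquiv 2 ℝ (fun _ : Fin N => L2 Ω)).symm.toContinuousLinearMap.comp
    (ContinuousLinearMap.pi fun m => (mulL Ω ρ).comp
      (((ContinuousLinearMap.snd ℝ (Fin d → L2 Ω) (L2 Ω)).comp
          (ContinuousLinearMap.snd ℝ (L2 Ω) ((Fin d → L2 Ω) × L2 Ω))).comp
            (ContinuousLinearMap.proj (R := ℝ) (φ := fun _ : Fin N => Triple Ω) m) -
        (mulL Ω c).comp (∑ n, s m n • (ContinuousLinearMap.fst ℝ (L2 Ω)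
          ((Fin d → L2 Ω) × L2 Ω)).comp
            (ContinuousLinearMap.proj (R := ℝ) (φ := fun _ : Fin N => Triple Ω) n))))

lemma systemOp_apply {d N : ℕ} (Ω : Set (E d)) (ρ c : E d → ℝ) (s : Fin N → Fin N → ℝ)
    (z : Fin N → Triple Ω) (m : Fin N) :
    systemOp Ω ρ c s z m = mulL Ω ρ ((z m).2.2 - mulL Ω c (∑ n, s m n • (z n).1)) := by
  simp [systemOp]

lemma norm_sum_smul_le {ι V : Type*} [Fintype ι] [SeminormedAddCommGroup V] [NormedSpace ℝ V]
    (s : ι → ℝ) (v : ι → V) : ‖∑ n, s n • v n‖ ≤ (∑ n, |s n|) * ∑ n, ‖v n‖ := by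
  refine (norm_sum_le _ _).trans ?_
  rw [Finset.sum_mul]
  refine Finset.sum_le_sum fun n _ => ?_
  rw [norm_smul, Real.norm_eq_abs]
  exact mul_le_mul_of_nonneg_left (Finset.single_le_sum (f := fun n => ‖v n‖)
    (fun _ _ => norm_nonneg _) (Finset.mem_univ n)) (abs_nonneg _)

theorem IsZeroTraceTriple.norm_mulL_exp_le {d : ℕ} {Ω : Set (E d)} (hΩ : MeasurableSet Ω)
    (hΩb : Bornology.IsBounded Ω) {L : ℝ} (hL : 0 < L) (hbox : Ω ⊆ box d L)
    {u : L2 Ω} {g : Fin d → L2 Ω} {h : L2 Ω} (H : IsZeroTraceTriple Ω u g h) (j : Fin d) {τ : ℝ}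
    (hτ : 0 ≤ τ) :
    2 * τ * (Real.pi / L) * ‖mulL Ω (fun x => Real.exp (τ * x j)) u‖ ≤
      ‖mulL Ω (fun x => Real.exp (τ * x j)) h‖ := by
  have hc : Continuous fun x : E d => Real.exp (τ * x j) := by fun_prop
  refine le_of_sq_le_sq ?_ (norm_nonneg _)
  rw [mul_pow, norm_sq_mulL hΩ hΩb hc, norm_sq_mulL hΩ hΩb hc]
  exact H.carleman hΩ hΩb hL hbox j hτ

lemma norm_triples_le {d N : ℕ} {Ω : Set (E d)} {z : Fin N → Triple Ω} {A B C : ℝ} (hA : 0 ≤ A)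
    (hB : 0 ≤ B) (hC : 0 ≤ C) (h1 : ∀ m, ‖(z m).1‖ ≤ A) (h2 : ∀ m i, ‖(z m).2.1 i‖ ≤ B)
    (h3 : ∀ m, ‖(z m).2.2‖ ≤ C) : ‖z‖ ≤ A + B + C := by
  refine (pi_norm_le_iff_of_nonneg (by positivity)).2 fun m => norm_prod_le_iff.2 ⟨?_,
    norm_prod_le_iff.2 ⟨(pi_norm_le_iff_of_nonneg (by positivity)).2 fun i => ?_, ?_⟩⟩
  · linarith [h1 m]
  · linarith [h2 m i]
  · linarith [h3 m]

/-- The system operator is bounded below on functions with vanishing Cauchy data. -/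
theorem exists_norm_le_systemOp {d N : ℕ} (hd : 1 ≤ d) {Ω : Set (E d)} (hΩ : MeasurableSet Ω)
    (hΩb : Bornology.IsBounded Ω) {ρ c : E d → ℝ} (hρ : Continuous ρ) (hρ0 : ∀ x, ρ x ≠ 0)
    (hc : Continuous c) (s : Fin N → Fin N → ℝ) :
    ∃ C, ∀ z : Fin N → Triple Ω, (∀ m, z m ∈ zeroTraceSubmodule Ω) →
      ‖z‖ ≤ C * ‖systemOp Ω ρ c s z‖ := by
  obtain ⟨L, hL, hbox⟩ := exists_box hΩb
  set κ := Real.pi / L with hκ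
  have hκ0 : 0 < κ := by positivity
  set S := ∑ m, ∑ n, |s m n| with hS
  have hS0 : 0 ≤ S := Finset.sum_nonneg fun _ _ => Finset.sum_nonneg fun _ _ => abs_nonneg _
  set γ := ‖mulL Ω c‖ with hγ
  have hγ0 : 0 ≤ γ := norm_nonneg _
  -- Chosen so that the Carleman constant `2 * τ * κ` exceeds the size `γ * S` of the coupling by
  -- exactly one.
  set τ := (γ * S + 1) / (2 * κ) with hτ
  have hτ0 : 0 ≤ τ := by positivity
  set j : Fin d := ⟨0, hd⟩
  set p : E d → ℝ := fun x => Real.exp (τ * x j) with hp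
  have hpc : Continuous p := by fun_prop
  have hp0 : ∀ x, p x ≠ 0 := fun x => (Real.exp_pos _).ne'
  set Ci := ‖mulL Ω ρ⁻¹‖ with hCi
  set Cp := ‖mulL Ω p‖ with hCp
  set Cq := ‖mulL Ω p⁻¹‖ with hCq
  have hCi0 : 0 ≤ Ci := norm_nonneg _
  have hCp0 : 0 ≤ Cp := norm_nonneg _
  have hCq0 : 0 ≤ Cq := norm_nonneg _
  have hrow : ∀ m, ∑ n, |s m n| ≤ S := fun m =>
    Finset.single_le_sum (f := fun m => ∑ n, |s m n|)
      (fun _ _ => Finset.sum_nonneg fun _ _ => abs_nonneg _) (Finset.mem_univ m)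
  set C1 : ℝ := Cp * (N * Ci) with hC1
  set C2 : ℝ := Ci + γ * (S * (N * (Cq * C1))) with hC2
  refine ⟨Cq * C1 + κ⁻¹ * C2 + C2, fun z hz => ?_⟩
  set β := ‖systemOp Ω ρ c s z‖ with hβ
  have hβ0 : 0 ≤ β := norm_nonneg _
  have hC10 : 0 ≤ C1 := by positivity
  have hC20 : 0 ≤ C2 := by positivity
  set r : Fin N → L2 Ω := fun m => (z m).2.2 - mulL Ω c (∑ n, s m n • (z n).1) with hr
  have hrβ : ∀ m, ‖r m‖ ≤ Ci * β := fun m => by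
    refine (norm_le_norm_mulL hΩ hΩb hρ hρ0 (r m)).trans (mul_le_mul_of_nonneg_left ?_ hCi0)
    have := PiLp.norm_apply_le (systemOp Ω ρ c s z) m
    rwa [systemOp_apply] at this
  -- After summation over `m` the coupling contributes `γ * S` times the left-hand sum; the surplus
  -- one in `γ * S + 1` is what remains. Here `β` is the norm of the residual.
  have hsum : ∑ m, ‖mulL Ω p (z m).1‖ ≤ C1 * β := by
    have h1 : ∀ m, (γ * S + 1) * ‖mulL Ω p (z m).1‖ ≤
        Cp * (Ci * β) + γ * ((∑ n, |s m n|) * ∑ n, ‖mulL Ω p (z n).1‖) := fun m => by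
      have h2 := IsZeroTraceTriple.norm_mulL_exp_le hΩ hΩb hL hbox (hz m) j hτ0
      have h3 : 2 * τ * (Real.pi / L) = γ * S + 1 := by
        rw [← hκ, hτ]; field_simp
      rw [h3] at h2
      refine h2.trans ?_
      -- The weight commutes with multiplication by `c` and with the constant coefficients, so the
      -- coupling is bounded by the same weighted norms.
      have h4 : mulL Ω p (z m).2.2 =
          mulL Ω p (r m) + mulL Ω c (∑ n, s m n • mulL Ω p (z n).1) := by
        have : ∑ n, s m n • mulL Ω p (z n).1 = mulL Ω p (∑ n, s m n • (z n).1) := by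
          simp only [map_sum, map_smul]
        rw [this, mulL_comm hΩ hΩb hc hpc, ← map_add, hr]
        simp
      rw [← hp, h4]
      refine (norm_add_le _ _).trans (add_le_add ?_ ?_)
      · exact ((mulL Ω p).le_opNorm _).trans (mul_le_mul_of_nonneg_left (hrβ m) hCp0)
      · exact ((mulL Ω c).le_opNorm _).trans
          (mul_le_mul_of_nonneg_left (norm_sum_smul_le _ _) hγ0)
    have h5 := Finset.sum_le_sum fun m (_ : m ∈ Finset.univ) => h1 m
    simp only [Finset.sum_add_distrib, ← Finset.mul_sum, ← Finset.sum_mul] at h5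
    rw [← hS, Finset.sum_const, Finset.card_univ, Fintype.card_fin, nsmul_eq_mul] at h5
    rw [hC1]
    linarith
  have hu : ∀ m, ‖(z m).1‖ ≤ Cq * (C1 * β) := fun m =>
    (norm_le_norm_mulL hΩ hΩb hpc hp0 _).trans (mul_le_mul_of_nonneg_left
      ((Finset.single_le_sum (f := fun m => ‖mulL Ω p (z m).1‖) (fun _ _ => norm_nonneg _)
        (Finset.mem_univ m)).trans hsum) hCq0)
  -- The Laplacian is recovered from the equation as the residual plus the coupling; the gradient
  -- bound then follows from it.
  have hh : ∀ m, ‖(z m).2.2‖ ≤ C2 * β := fun m => by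
    have h1 : (z m).2.2 = r m + mulL Ω c (∑ n, s m n • (z n).1) := by simp [hr]
    have h2 : ∑ n, ‖(z n).1‖ ≤ N * (Cq * (C1 * β)) := by
      refine (Finset.sum_le_sum fun n _ => hu n).trans ?_
      simp
    rw [h1]
    calc _ ≤ ‖r m‖ + ‖mulL Ω c (∑ n, s m n • (z n).1)‖ := norm_add_le _ _
      _ ≤ Ci * β + γ * (S * (N * (Cq * (C1 * β)))) := by
        refine add_le_add (hrβ m) (((mulL Ω c).le_opNorm _).trans
          (mul_le_mul_of_nonneg_left ((norm_sum_smul_le _ _).trans ?_) hγ0))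
        exact mul_le_mul (hrow m) h2 (Finset.sum_nonneg fun _ _ => norm_nonneg _) hS0
      _ = C2 * β := by rw [hC2]; ring
  have hg : ∀ m i, ‖(z m).2.1 i‖ ≤ κ⁻¹ * (C2 * β) := fun m i => by
    have h1 := (IsZeroTraceTriple.norm_grad_le hΩ hΩb hL hbox (hz m) i).trans (hh m)
    rwa [le_inv_mul_iff₀ hκ0]
  have e4 : (Cq * C1 + κ⁻¹ * C2 + C2) * β = Cq * (C1 * β) + κ⁻¹ * (C2 * β) + C2 * β := by ring
  rw [e4]
  exact norm_triples_le (by positivity) (by positivity) (by positivity) hu hg hh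

/-! ### The minimization problem -/

/-- The square root of the weight moves inside the norm; the `PiLp 2` structure turns the sum over
components into one Hilbert norm. -/
lemma weightedResidual_eq_norm_sq {d N : ℕ} {Ω : Set (E d)} (hΩ : MeasurableSet Ω)
    (hΩb : Bornology.IsBounded Ω) {x₀ : E d} {b lam β : ℝ} {c : E d → ℝ} (hc : Continuous c)
    {T : ℝ} {Ψ : ℕ → ℝ → ℝ} {F : Fin N → E d → ℝ} (hF : ∀ m, MemLp (F m) 2 (volume.restrict Ω))
    {ρ : E d → ℝ} (hρ : Continuous ρ) (hρw : ∀ x, ρ x ^ 2 = carlemanWeight x₀ b lam β x)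
    (u : Fin N → L2 Ω) :
    weightedResidual Ω x₀ b lam β c T Ψ F u =
      ‖(WithLp.toLp 2 fun m => mulL Ω ρ (weakLaplacian Ω (u m) -
        mulL Ω c (∑ n : Fin N, sCoeff T Ψ m n • u n) + (hF m).toLp (F m)) :
          PiLp 2 fun _ : Fin N => L2 Ω)‖ ^ 2 := by
  rw [PiLp.norm_sq_eq_of_L2, weightedResidual]
  refine Finset.sum_congr rfl fun m _ => ?_
  rw [norm_sq_mulL hΩ hΩb hρ]
  apply integral_congr_ae
  have h3 : (∑ n : Fin N, sCoeff T Ψ m n • u n : L2 Ω) =ᵐ[volume.restrict Ω]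
      fun x => ∑ n : Fin N, sCoeff T Ψ m n * u n x := by
    have h4 : ∀ᵐ x ∂(volume.restrict Ω), ∀ n : Fin N,
        (sCoeff T Ψ m n • u n : L2 Ω) x = sCoeff T Ψ m n * u n x :=
      ae_all_iff.2 fun n => Lp.coeFn_smul _ _
    filter_upwards [h4, Lp.coeFn_fun_finsetSum Finset.univ fun n : Fin N => sCoeff T Ψ m n • u n]
      with x h5 h6
    rw [h6]
    exact Finset.sum_congr rfl fun n _ => h5 n
  filter_upwards [h3, mulL_ae hΩ hΩb hc (∑ n : Fin N, sCoeff T Ψ m n • u n),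
    (hF m).coeFn_toLp, Lp.coeFn_sub (weakLaplacian Ω (u m))
      (mulL Ω c (∑ n : Fin N, sCoeff T Ψ m n • u n)),
    Lp.coeFn_add (weakLaplacian Ω (u m) - mulL Ω c (∑ n : Fin N, sCoeff T Ψ m n • u n))
      ((hF m).toLp (F m))] with x h1 h2 h4 h5 h6
  rw [h6, Pi.add_apply, h5, Pi.sub_apply, h2, h1, h4, mul_pow, hρw]

theorem exists_isUniqueMinimizer {d N : ℕ} (hd : 1 ≤ d) {Ω : Set (E d)} (hΩ : IsOpen Ω)
    (hΩb : Bornology.IsBounded Ω) (x₀ : E d) (b lam : ℝ) {β : ℝ} (hβ : 0 ≤ β) {c : E d → ℝ}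
    (hc : Continuous c) (T : ℝ) (Ψ : ℕ → ℝ → ℝ) {F : Fin N → E d → ℝ}
    (hF : ∀ m, MemLp (F m) 2 (volume.restrict Ω)) {f g : Fin N → E d → ℝ}
    (hH : (admissibleSet Ω f g).Nonempty) :
    ∃ u, IsUniqueMinimizer (weightedResidual Ω x₀ b lam β c T Ψ F) (admissibleSet Ω f g) u := by
  obtain ⟨v, hv⟩ := hH
  set ρ : E d → ℝ := fun x => Real.exp (lam * b ^ (-β) * dist x x₀ ^ β) with hρd
  -- The condition `0 ≤ β` gives continuity of the power of the distance at `x₀` as well.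
  have hρ : Continuous ρ := Real.continuous_exp.comp (continuous_const.mul
    ((continuous_id.dist continuous_const).rpow_const fun _ => Or.inr hβ))
  have hρ0 : ∀ x, ρ x ≠ 0 := fun x => (Real.exp_pos _).ne'
  have hρw : ∀ x, ρ x ^ 2 = carlemanWeight x₀ b lam β x := fun x => by
    rw [hρd, carlemanWeight, ← Real.exp_nat_mul]
    congr 1
    push_cast
    ring
  set s : Fin N → Fin N → ℝ := fun m n => sCoeff T Ψ m n with hs
  obtain ⟨C, hC⟩ := exists_norm_le_systemOp hd hΩ.measurableSet hΩb hρ hρ0 hc s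
  let Z : Submodule ℝ (Fin N → Triple Ω) :=
    Submodule.pi univ fun _ => zeroTraceSubmodule Ω
  have hZ : ∀ z : Z, ∀ m, IsZeroTraceTriple Ω (z.1 m).1 (z.1 m).2.1 (z.1 m).2.2 :=
    fun z m => z.2 m trivial
  have hZc : IsClosed (Z : Set (Fin N → Triple Ω)) :=
    isClosed_set_pi fun m _ => isClosed_zeroTraceSubmodule Ω
  have : CompleteSpace Z := hZc.completeSpace_coe
  let y : PiLp 2 (fun _ : Fin N => L2 Ω) := WithLp.toLp 2 fun m =>
    mulL Ω ρ (weakLaplacian Ω (v m) - mulL Ω c (∑ n, s m n • v n) + (hF m).toLp (F m))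
  obtain ⟨z, hz⟩ := exists_unique_norm_minimizer ((systemOp Ω ρ c s).comp Z.subtypeL) C
    (fun z => hC z.1 fun m => z.2 m trivial) y
  -- This and `hsurj` parametrize the admissible set by `Z`, with base point `v`; `y` is the
  -- weighted residual of `v`.
  have hmem : ∀ z : Z, (fun m => v m + (z.1 m).1) ∈ admissibleSet Ω f g := fun z m =>
    ⟨(hv m).1.add ((hZ z m).memH2 hΩ hΩb), (hZ z m).hasDirichletTrace_add hΩ hΩb (hv m).1 (hv m).2.1,
      (hZ z m).hasNeumannTrace_add hΩ hΩb (hv m).1 (hv m).2.2⟩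
  have hval : ∀ z : Z, weightedResidual Ω x₀ b lam β c T Ψ F (fun m => v m + (z.1 m).1) =
      ‖((systemOp Ω ρ c s).comp Z.subtypeL) z + y‖ ^ 2 := fun z => by
    rw [weightedResidual_eq_norm_sq hΩ.measurableSet hΩb hc hF hρ hρw]
    congr 2
    ext1 m
    rw [PiLp.add_apply]
    simp only [ContinuousLinearMap.comp_apply, Submodule.subtypeL_apply, systemOp_apply, y]
    rw [weakLaplacian_add hΩ hΩb (hv m).1 ((hZ z m).memH2 hΩ hΩb), (hZ z m).weakLaplacian_eq hΩ hΩb]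
    simp only [smul_add, Finset.sum_add_distrib, map_add, map_sub, hs]
    abel
  have hsurj : ∀ u ∈ admissibleSet Ω f g, ∃ z : Z, u = fun m => v m + (z.1 m).1 := fun u hu => by
    refine ⟨⟨fun m => (u m - v m, fun i => weakPartial Ω i (u m) - weakPartial Ω i (v m),
      weakLaplacian Ω (u m) - weakLaplacian Ω (v m)), fun m _ => ?_⟩, ?_⟩
    · exact isZeroTraceTriple_sub (hu m).2.1 (hu m).2.2 (hv m).2.1 (hv m).2.2
    · ext1 m
      simp
  refine ⟨fun m => v m + (z.1 m).1, hmem z, fun u hu => ?_, fun u hu hmin => ?_⟩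
  · obtain ⟨z', rfl⟩ := hsurj u hu
    simp only [mem_ofPred_eq, hval]
    have := (hz z').1
    gcongr
  · obtain ⟨z', rfl⟩ := hsurj u hu
    have h1 := hmin (hmem z)
    simp only [mem_ofPred_eq, hval] at h1
    rw [(hz z').2 (le_of_sq_le_sq h1 (norm_nonneg _))]

/-! ### The nonlinear term -/

lemma continuous_qCoeff {N : ℕ} {T : ℝ} (hT : 0 ≤ T) {Ψ : ℕ → ℝ → ℝ}
    (hΨ : ∀ n : Fin N, ContinuousOn (Ψ n) (Icc 0 T)) {q : ℝ → ℝ} (hq : Continuous q) (m : Fin N) :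
    Continuous (qCoeff T Ψ q m) := by
  -- Constant extension beyond `[0, T]` makes the integrand jointly continuous everywhere without
  -- changing the integral.
  set Φ : Fin N → ℝ → ℝ := fun n => IccExtend hT ((Icc 0 T).domRestrict (Ψ n)) with hΦ
  have hc : ∀ n, Continuous (Φ n) := fun n => (hΨ n).domRestrict.Icc_extend'
  have heq : qCoeff T Ψ q m = fun v => ∫ t in (0 : ℝ)..T, q (∑ n, v n * Φ n t) * Φ m t := by
    ext v
    refine intervalIntegral.integral_congr fun t ht => ?_
    rw [uIcc_of_le hT] at ht
    simp [hΦ, IccExtend_of_mem hT _ ht]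
  rw [heq]
  refine intervalIntegral.continuous_parametric_intervalIntegral_of_continuous' ?_ 0 T
  have h1 : ∀ n, Continuous fun p : (Fin N → ℝ) × ℝ => Φ n p.2 := fun n =>
    (hc n).comp continuous_snd
  exact (hq.comp (continuous_finsetSum _ fun n _ =>
    ((continuous_apply n).comp continuous_fst).mul (h1 n))).mul (h1 m)

lemma cutoff_mem_Icc {M T : ℝ} (hM : 0 ≤ M) (s : ℝ) :
    cutoff M T s ∈ Icc (-(M * √T)) (M * √T) := by
  have : 0 ≤ M * √T := by positivity
  exact ⟨le_max_left _ _, max_le (by linarith) (min_le_right _ _)⟩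

/-- The truncated arguments stay in a compact cube, where the continuous `qCoeff` is bounded; no
growth condition on `q` is needed. -/
lemma memLp_qCoeff_cutoff {d N : ℕ} {Ω : Set (E d)} (hΩb : Bornology.IsBounded Ω) {T : ℝ}
    (hT : 0 ≤ T) {Ψ : ℕ → ℝ → ℝ} (hΨ : ∀ n : Fin N, ContinuousOn (Ψ n) (Icc 0 T)) {q : ℝ → ℝ}
    (hq : Continuous q) {M : ℝ} (hM : 0 ≤ M) (u : Fin N → L2 Ω) (m : Fin N) :
    MemLp (fun x => qCoeff T Ψ q m fun n => cutoff M T (u n x)) 2 (volume.restrict Ω) := by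
  have : IsFiniteMeasure (volume.restrict Ω) := ⟨by simpa using hΩb.measure_lt_top⟩
  have hc := continuous_qCoeff hT hΨ hq m
  obtain ⟨C, hC⟩ := ((isCompact_univ_pi fun _ : Fin N =>
    isCompact_Icc (a := -(M * √T)) (b := M * √T)).image hc.norm).isBounded.bddAbove
  have hcut : Continuous (cutoff M T) := by unfold cutoff; fun_prop
  refine MemLp.of_bound ?_ C (ae_of_all _ fun x => hC ⟨_, fun n _ => cutoff_mem_Icc hM _, rfl⟩)
  exact (hc.measurable.comp_aemeasurable (aemeasurable_pi_lambda _ fun n =>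
    hcut.measurable.comp_aemeasurable (Lp.aestronglyMeasurable (u n)).aemeasurable)
    ).aestronglyMeasurable

/-! ### The sequence of minimizers -/

lemma existsUnique_seq {X : Type*} {Q : X → Prop} {R : X → X → Prop} (h0 : ∃! u, Q u)
    (h : ∀ w, ∃! u, R w u) : ∃! U : ℕ → X, Q (U 0) ∧ ∀ k, R (U k) (U (k + 1)) := by
  choose S hS hS' using h
  obtain ⟨u₀, hu₀, hu₀'⟩ := h0
  refine ⟨fun k => Nat.rec u₀ (fun _ w => S w) k, ⟨hu₀, fun k => hS _⟩, fun V hV => ?_⟩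
  funext k
  induction k with
  | zero => exact hu₀' _ hV.1
  | succ k ih =>
    have := hS' _ _ (hV.2 k)
    rw [this, ih]

lemma IsUniqueMinimizer.eq {X : Type*} {Φ : X → ℝ} {H : Set X} {u v : X}
    (hu : IsUniqueMinimizer Φ H u) (hv : IsUniqueMinimizer Φ H v) : v = u :=
  hu.2.2 v hv.1 hv.2.1

end CarlemanLS

end

/-! ### The main theorem. -/

theorem mainTheorem4 {d : ℕ} (hd : 1 ≤ d)
    -- the bounded domain with smooth boundary
    (Ω : Set (CarlemanLS.E d)) (hΩ_open : IsOpen Ω) (hΩ_ne : Ω.Nonempty)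
    (hΩ_bdd : Bornology.IsBounded Ω) (hΩ_smooth : CarlemanLS.HasSmoothBoundary Ω)
    -- the coefficient `c`
    (c : CarlemanLS.E d → ℝ) (hc : ContDiff ℝ 1 c) (c₀ : ℝ) (hc₀ : 0 < c₀) (hc_lb : ∀ x, c₀ ≤ c x)
    -- the time basis and the cut-off number
    (T : ℝ) (hT : 0 < T) (Ψ : ℕ → ℝ → ℝ) (hΨ : CarlemanLS.IsOrthonormalBasisL2 T Ψ) (N : ℕ)
    (hΨ_ac : ∀ n : Fin N, AbsolutelyContinuousOnInterval (Ψ n) 0 T)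
    -- the parameters of the Carleman weight
    (x₀ : CarlemanLS.E d) (hx₀ : ∀ x ∈ closure Ω, 1 < dist x x₀)
    (b : ℝ) (hb : ∀ x ∈ closure Ω, dist x x₀ < b) :
    ∃ lam₀ β₀ : ℝ, ∀ lam ≥ lam₀, ∀ β ≥ β₀,
      -- the nonlinearity, the cut-off level and the boundary data
      ∀ (q : ℝ → ℝ), ContDiff ℝ 1 q → ∀ M : ℝ, 0 < M →
      ∀ f g : Fin N → CarlemanLS.E d → ℝ,
        (∀ m, MemLp (f m) 2 (CarlemanLS.surfaceMeasure Ω)) →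
        (∀ m, MemLp (g m) 2 (CarlemanLS.surfaceMeasure Ω)) →
        (CarlemanLS.admissibleSet Ω f g).Nonempty →
        ∃! U : ℕ → Fin N → CarlemanLS.L2 Ω, ∀ k : ℕ,
          CarlemanLS.IsUniqueMinimizer (CarlemanLS.J Ω x₀ b lam β c T Ψ q M U k)
            (CarlemanLS.admissibleSet Ω f g) (U k) := by
  -- The thresholds can be zero because the auxiliary weight `exp (τ * x j)`, not the Carleman
  -- weight, absorbs the coupling.
  refine ⟨0, 0, fun lam _ β hβ q hq M hM f g _ _ hH => ?_⟩
  have hΨc : ∀ n : Fin N, ContinuousOn (Ψ n) (Icc 0 T) := fun n => by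
    simpa [uIcc_of_le hT.le] using (hΨ_ac n).continuousOn
  have hex : ∀ F : Fin N → CarlemanLS.E d → ℝ, (∀ m, MemLp (F m) 2 (volume.restrict Ω)) →
      ∃! u, CarlemanLS.IsUniqueMinimizer (CarlemanLS.weightedResidual Ω x₀ b lam β c T Ψ F)
        (CarlemanLS.admissibleSet Ω f g) u := fun F hF => by
    obtain ⟨u, hu⟩ := CarlemanLS.exists_isUniqueMinimizer hd hΩ_open hΩ_bdd x₀ b lam hβ
      hc.continuous T Ψ hF hH
    exact ⟨u, hu, fun v hv => hu.eq hv⟩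
  obtain ⟨U, ⟨h0, hs⟩, hU⟩ := CarlemanLS.existsUnique_seq (hex (fun _ _ => 0) fun _ => MemLp.zero)
    fun w => hex _ (CarlemanLS.memLp_qCoeff_cutoff hΩ_bdd hT.le hΨc hq.continuous hM.le w)
  exact ⟨U, fun k => Nat.casesOn k h0 hs, fun V hV => hU V ⟨hV 0, fun k => hV (k + 1)⟩⟩
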